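/- Theorem 2.6 (Corrected Beiter conjecture). For $n \ge 1$ let $\Phi_n(x)=\sum_{i=0}^{\varphi(n)} c_i x^i \in \mathbb{Z}[x]$ be the $n$-th cyclotomic polynomial and let $A(n)=\max\{|c_i| : 0\le i\le \varphi(n)\}$. Let $p$ be an odd prime. Then for all primes $q, r$ with $p<q<r$, $$A(pqr)\le \tfrac{2}{3}\,p .$$ Consequently the maximum $M(p)=\max\{A(pqr) : q, r \text{ prime},\ p<q<r\}$ exists, and $M(p)\le \tfrac{2}{3}\,p$. -/

import Mathlib

/-- `A(n)`: the largest absolute value of a coefficient `c_i`, `0 ≤ i ≤ φ(n)`, of the `n`-th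
cyclotomic polynomial (whose coefficients are integers). -/
noncomputable def cyclotomicHeight (n : ℕ) : ℕ :=
  (Finset.range (n.totient + 1)).sup fun i => ((Polynomial.cyclotomic n ℤ).coeff i).natAbs

/-- The set of all values `A(pqr)`, where `q` and `r` are primes with `p < q < r`. -/
def ternaryHeights (p : ℕ) : Set ℕ :=
  {a | ∃ q r : ℕ, q.Prime ∧ r.Prime ∧ p < q ∧ q < r ∧ a = cyclotomicHeight (p * q * r)}

/-- `M(p)`: the maximum of `A(pqr)` over all primes `q`, `r` with `p < q < r`. -/
noncomputable def ternaryMaxHeight (p : ℕ) : ℕ :=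
  sSup (ternaryHeights p)

/-! Multiplying Φ_{pqr} by (X^{pqr} - 1)², which does not affect coefficients below pqr, turns the
denominators of the product formula into geometric sums. The n-th coefficient becomes a sum over i <
p of χ(n-i) - χ(n-i-r) - χ(n-i-q) + χ(n-i-q-r), where χ marks the integers aqr + brp + cpq with a <
p, b < q, c < r. By the Chinese remainder theorem, and after division by qr, χ is the indicator of x
+ y ≤ s for two points x, y on a circle of length p. The four terms sit at the corners of a
rectangle with integer sides l, r, inverse to q, r modulo p, which moves at constant velocity as i
grows (`exists_rectangleWalk`). Modulo p, x + y is s minus an integer row, and the row drops by c ≡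
±lr at each step. So each row is visited exactly once. Exchanging coordinates, flipping a side and
reversing time reduce everything to l, r, c < p/2 (`RectangleWalk.abs_total_le`).

The row determines the second difference up to a defect of 0 or 1 (`diffTwo_le_rowMax`), and the row
maxima add up to p - max(l, r). Hence the total is p - max(l, r) - e, with e the number of
exceptional indices (`CircleWalk.total_eq`). The lower bound is immediate. For the upper bound
suppose the total exceeds 2p/3, so that e + max(l, r) < p/3. Unexceptional points of the top rows u
≥ l + r lie in the box x < l, y < r, which confines their rows to a window of l + r rows; thus l and
r cannot be small either (`Extremal.le`). The contradiction then depends on c: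

For most c some k has kc well between p/3 and 2p/3. Many pairs of unexceptional top points are 2k
steps apart, so 2k steps displace each coordinate little. Halving this displacement, k steps give
one coordinate an additional half turn, which throws points out of the box and creates too many
exceptions (`Extremal.c_cases`).

For c = 1 the rows decrease one at a time, and monotonicity or winding numbers of the coordinates
give the contradiction (`Extremal.c_ne_one`).

For c close to p/3, one or two steps relate top points to each other. Counting forces l and r close
to p/3 too, against c ≡ ±lr, apart from a few configurations excluded directly
(`Extremal.not_near_third`).

The prime 7 is treated by hand, and for smaller primes the inequalities on l, r are already
inconsistent. -/

/-- The representative of `x - l` in `[0, p)`, for `x` in `[0, p)` and `0 ≤ l ≤ p`. -/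
noncomputable def shiftDown (p l : ℕ) (x : ℝ) : ℝ := if (l : ℝ) ≤ x then x - l else x - l + p

/-- The second difference of the indicator of `x + y ≤ s` along the shifts by `l` and `r` on the
circle of length `p`. -/
noncomputable def diffTwo (p l r : ℕ) (s x y : ℝ) : ℤ :=
  (if x + y ≤ s then 1 else 0) - (if shiftDown p l x + y ≤ s then 1 else 0)
    - (if x + shiftDown p r y ≤ s then 1 else 0)
    + (if shiftDown p l x + shiftDown p r y ≤ s then 1 else 0)

/-- The largest possible value of `diffTwo` in the row `u`. -/
def rowMax (l r u : ℕ) : ℤ := if u < min l r ∨ l + r ≤ u then 1 else 0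

theorem diffTwo_comm (p l r : ℕ) (s x y : ℝ) : diffTwo p r l s y x = diffTwo p l r s x y := by
  unfold diffTwo
  rw [add_comm y x, add_comm (shiftDown p r y) x, add_comm y (shiftDown p l x),
    add_comm (shiftDown p r y) (shiftDown p l x)]
  ring

theorem rowMax_comm (l r u : ℕ) : rowMax r l u = rowMax l r u := by
  unfold rowMax; rw [min_comm, add_comm]

theorem eq_of_congr {p : ℝ} {a b : ℝ} (ha : 0 ≤ a) (ha' : a < p) (hb : 0 ≤ b) (hb' : b < p)
    {z : ℤ} (h : a = b + p * z) : a = b := by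
  have hp : 0 < p := by linarith
  have h1 : z < 1 := by
    by_contra hz
    have : (1 : ℝ) ≤ z := by exact_mod_cast not_lt.mp hz
    nlinarith
  have h2 : -1 < z := by
    by_contra hz
    have : (z : ℝ) ≤ -1 := by exact_mod_cast not_lt.mp hz
    nlinarith
  have : z = 0 := by omega
  subst this; simpa using h

theorem winding_bounds {p : ℝ} (hp : 0 < p) {t : ℝ} {j : ℤ} (h : t = p * j) (h1 : -2 * p < t)
    (h2 : t < 3 * p) : j = -1 ∨ j = 0 ∨ j = 1 ∨ j = 2 := by
  have a1 : -2 < j := by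
    by_contra hz
    have : (j : ℝ) ≤ -2 := by exact_mod_cast not_lt.mp hz
    nlinarith
  have a2 : j < 3 := by
    by_contra hz
    have : (3 : ℝ) ≤ j := by exact_mod_cast not_lt.mp hz
    nlinarith
  omega

/-! ### Values of the second difference in a given row. -/

section Classification

variable {p l r u : ℕ} {s x y : ℝ} {j : ℤ}

-- The row fixes all four corner sums modulo p. Only the winding number j and the choices of
-- representative in `shiftDown` remain free, which leaves finitely many linear systems.
set_option maxHeartbeats 1000000 in
theorem diffTwo_le_rowMax (hs : 0 ≤ s) (hs' : s < p) (hx : 0 ≤ x) (hx' : x < p) (hy : 0 ≤ y)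
    (hy' : y < p) (hl : 2 * l < p) (hr : 2 * r < p) (hu : u < p)
    (h : x + y + u = s + l + r + p * j) :
    rowMax l r u - 1 ≤ diffTwo p l r s x y ∧ diffTwo p l r s x y ≤ rowMax l r u := by
  have hl' : 2 * (l : ℝ) < p := by exact_mod_cast hl
  have hr' : 2 * (r : ℝ) < p := by exact_mod_cast hr
  have hu' : (u : ℝ) < p := by exact_mod_cast hu
  have l0 : (0 : ℝ) ≤ l := Nat.cast_nonneg l
  have r0 : (0 : ℝ) ≤ r := Nat.cast_nonneg r
  have u0 : (0 : ℝ) ≤ u := Nat.cast_nonneg u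
  have hj := winding_bounds (by linarith) (show x + y + u - s - l - r = p * j by linarith)
    (by linarith) (by linarith)
  unfold rowMax
  by_cases h1 : u < min l r
  · rw [if_pos (Or.inl h1)]
    have a1 : (u : ℝ) < l := by exact_mod_cast (lt_of_lt_of_le h1 (min_le_left _ _))
    have a2 : (u : ℝ) < r := by exact_mod_cast (lt_of_lt_of_le h1 (min_le_right _ _))
    unfold diffTwo shiftDown
    clear hl hr hu h1
    rcases hj with rfl | rfl | rfl | rfl <;> push_cast at h <;> split_ifs <;>
      first | norm_num; done | (exfalso; linarith)
  by_cases h2 : l + r ≤ u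
  · rw [if_pos (Or.inr h2)]
    have a1 : (l + r : ℝ) ≤ u := by exact_mod_cast h2
    unfold diffTwo shiftDown
    clear hl hr hu h1 h2
    rcases hj with rfl | rfl | rfl | rfl <;> push_cast at h <;> split_ifs <;>
      first | norm_num; done | (exfalso; linarith)
  · rw [if_neg (by tauto)]
    have a1 : (u : ℝ) < l + r := by exact_mod_cast not_le.mp h2
    have a2 : (l : ℝ) ≤ u ∨ (r : ℝ) ≤ u := by
      rcases min_le_iff.mp (not_lt.mp h1) with h | h
      · left; exact_mod_cast h
      · right; exact_mod_cast h
    unfold diffTwo shiftDown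
    clear hl hr hu h1 h2
    rcases a2 with a2 | a2 <;>
    rcases hj with rfl | rfl | rfl | rfl <;> push_cast at h <;> split_ifs <;>
      first | norm_num; done | (exfalso; linarith)

/-- Points in the top rows at which `diffTwo` is maximal. -/
theorem top_row_maximal (hs : 0 ≤ s) (hs' : s < p) (hx : 0 ≤ x) (hx' : x < p) (hy : 0 ≤ y)
    (hy' : y < p) (hl : 2 * l < p) (hr : 2 * r < p) (hu : u < p)
    (h : x + y + u = s + l + r + p * j) (h2 : l + r ≤ u)
    (hd : diffTwo p l r s x y = rowMax l r u) : x < l ∧ y < r ∧ x + y + u = s + l + r := by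
  have hl' : 2 * (l : ℝ) < p := by exact_mod_cast hl
  have hr' : 2 * (r : ℝ) < p := by exact_mod_cast hr
  have hu' : (u : ℝ) < p := by exact_mod_cast hu
  have l0 : (0 : ℝ) ≤ l := Nat.cast_nonneg l
  have r0 : (0 : ℝ) ≤ r := Nat.cast_nonneg r
  have u0 : (0 : ℝ) ≤ u := Nat.cast_nonneg u
  have hj := winding_bounds (by linarith) (show x + y + u - s - l - r = p * j by linarith)
    (by linarith) (by linarith)
  rw [rowMax, if_pos (Or.inr h2)] at hd
  have a1 : (l + r : ℝ) ≤ u := by exact_mod_cast h2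
  unfold diffTwo shiftDown at hd
  clear hl hr hu h2
  rcases hj with rfl | rfl | rfl | rfl <;> push_cast at h <;> split_ifs at hd <;>
    first
    | (exfalso; linarith)
    | (exfalso; revert hd; norm_num; done)
    | exact ⟨by linarith, by linarith, by linarith⟩

/-- Points in the middle rows at which `diffTwo` is maximal. -/
theorem middle_row_maximal (hl : 2 * l < p) (hr : 2 * r < p)
    (h : x + y + u = s + l + r) (h1 : max l r ≤ u) (h2 : u < l + r)
    (hd : diffTwo p l r s x y = rowMax l r u) : x < l ∧ y < r := by
  have hl' : 2 * (l : ℝ) < p := by exact_mod_cast hl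
  have hr' : 2 * (r : ℝ) < p := by exact_mod_cast hr
  have l0 : (0 : ℝ) ≤ l := Nat.cast_nonneg l
  have r0 : (0 : ℝ) ≤ r := Nat.cast_nonneg r
  rw [rowMax, if_neg (by omega)] at hd
  have a1 : (l : ℝ) ≤ u := by exact_mod_cast (le_trans (le_max_left _ _) h1)
  have a2 : (r : ℝ) ≤ u := by exact_mod_cast (le_trans (le_max_right _ _) h1)
  have a3 : (u : ℝ) < l + r := by exact_mod_cast h2
  unfold diffTwo shiftDown at hd
  clear hl hr h2 h1
  split_ifs at hd <;>
    first
    | (exfalso; linarith)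
    | (exfalso; revert hd; norm_num; done)
    | exact ⟨by linarith, by linarith⟩

/-- Points in the bottom rows at which `diffTwo` is maximal. -/
theorem bottom_row_maximal (hs : 0 ≤ s) (hs' : s < p) (hx : 0 ≤ x) (hx' : x < p) (hy : 0 ≤ y)
    (hy' : y < p) (hl : 2 * l < p) (hr : 2 * r < p) (hu : u < p)
    (h : x + y + u = s + l + r + p * j) (h1 : u < min l r)
    (hd : diffTwo p l r s x y = rowMax l r u) :
    (x + y + u = s + l + r - p ∧ (x < l ∨ y < r)) ∨
      (x + y + u = s + l + r ∧ l ≤ x ∧ r ≤ y) := by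
  have hl' : 2 * (l : ℝ) < p := by exact_mod_cast hl
  have hr' : 2 * (r : ℝ) < p := by exact_mod_cast hr
  have hu' : (u : ℝ) < p := by exact_mod_cast hu
  have l0 : (0 : ℝ) ≤ l := Nat.cast_nonneg l
  have r0 : (0 : ℝ) ≤ r := Nat.cast_nonneg r
  have u0 : (0 : ℝ) ≤ u := Nat.cast_nonneg u
  have hj := winding_bounds (by linarith) (show x + y + u - s - l - r = p * j by linarith)
    (by linarith) (by linarith)
  rw [rowMax, if_pos (Or.inl h1)] at hd
  have a1 : (u : ℝ) < l := by exact_mod_cast (lt_of_lt_of_le h1 (min_le_left _ _))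
  have a2 : (u : ℝ) < r := by exact_mod_cast (lt_of_lt_of_le h1 (min_le_right _ _))
  unfold diffTwo shiftDown at hd
  clear hl hr hu h1
  rcases hj with rfl | rfl | rfl | rfl <;> push_cast at h <;> split_ifs at hd <;>
    first
    | (exfalso; linarith)
    | (exfalso; revert hd; norm_num; done)
    | exact Or.inl ⟨by linarith, Or.inl (by linarith)⟩
    | exact Or.inl ⟨by linarith, Or.inr (by linarith)⟩
    | exact Or.inr ⟨by linarith, by linarith, by linarith⟩

end Classification

/-! ### Walks on a product of two circles and their exceptional indices. -/

/-- A walk on the product of two circles of length `p`, in which the sum of the two coordinates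
is determined, modulo `p`, by an integer row `u m`. -/
structure CircleWalk where
  p : ℕ
  l : ℕ
  r : ℕ
  c : ℕ
  s : ℝ
  a : ℝ
  x : ℕ → ℝ
  y : ℕ → ℝ
  u : ℕ → ℕ
  prime : p.Prime
  two_l : 2 * l < p
  two_r : 2 * r < p
  c_pos : 0 < c
  two_c : 2 * c < p
  rel : (p : ℤ) ∣ c - l * r ∨ (p : ℤ) ∣ c + l * r
  s_nonneg : 0 ≤ s
  s_lt : s < p
  x_nonneg : ∀ m < p, 0 ≤ x m
  x_lt : ∀ m < p, x m < p
  y_nonneg : ∀ m < p, 0 ≤ y m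
  y_lt : ∀ m < p, y m < p
  u_lt : ∀ m < p, u m < p
  x_step : ∀ m k, m + k < p → ∃ z : ℤ, x (m + k) = x m + k * a + p * z
  y_step : ∀ m k, m + k < p → ∃ z : ℤ, y (m + k) = y m + k * (c - a) + p * z
  sum : ∀ m < p, ∃ z : ℤ, x m + y m + u m = s + l + r + p * z

namespace CircleWalk

variable (W : CircleWalk)

/-- The walk with the two coordinates exchanged. -/
def swap : CircleWalk where
  p := W.p
  l := W.r
  r := W.l
  c := W.c
  s := W.s
  a := W.c - W.a
  x := W.y
  y := W.x
  u := W.u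
  prime := W.prime
  two_l := W.two_r
  two_r := W.two_l
  c_pos := W.c_pos
  two_c := W.two_c
  rel := by rw [mul_comm]; exact W.rel
  s_nonneg := W.s_nonneg
  s_lt := W.s_lt
  x_nonneg := W.y_nonneg
  x_lt := W.y_lt
  y_nonneg := W.x_nonneg
  y_lt := W.x_lt
  u_lt := W.u_lt
  x_step := W.y_step
  y_step := fun m k h => by
    obtain ⟨z, hz⟩ := W.x_step m k h
    exact ⟨z, by rw [hz]; ring⟩
  sum := fun m h => by
    obtain ⟨z, hz⟩ := W.sum m h
    exact ⟨z, by linarith⟩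

/-- The sum of the second differences along the walk. -/
noncomputable def total : ℤ :=
  ∑ m ∈ Finset.range W.p, diffTwo W.p W.l W.r W.s (W.x m) (W.y m)

open Classical in
/-- The indices at which the second difference is not the maximal one of its row. -/
noncomputable def exc : Finset ℕ :=
  (Finset.range W.p).filter fun m =>
    diffTwo W.p W.l W.r W.s (W.x m) (W.y m) ≠ rowMax W.l W.r (W.u m)

theorem swap_exc : W.swap.exc = W.exc := by
  unfold exc
  simp only [swap, diffTwo_comm, rowMax_comm]

theorem mem_exc {m : ℕ} : m ∈ W.exc ↔
    m < W.p ∧ diffTwo W.p W.l W.r W.s (W.x m) (W.y m) ≠ rowMax W.l W.r (W.u m) := by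
  simp [exc]

theorem p_pos : 0 < W.p := W.prime.pos

theorem u_step (m k : ℕ) (h : m + k < W.p) :
    ∃ z : ℤ, (W.u (m + k) : ℤ) = W.u m - k * W.c + W.p * z := by
  obtain ⟨z1, h1⟩ := W.x_step m k h
  obtain ⟨z2, h2⟩ := W.y_step m k h
  obtain ⟨z3, h3⟩ := W.sum m (by omega)
  obtain ⟨z4, h4⟩ := W.sum (m + k) h
  refine ⟨z4 - z3 - z1 - z2, ?_⟩
  have : (W.u (m + k) : ℝ) = W.u m - k * W.c + W.p * (z4 - z3 - z1 - z2) := by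
    rw [h1, h2] at h4; linarith
  exact_mod_cast this

/-- A return to the same row after 0 < k < p steps would force p to divide kc, although 0 < c < p.
-/
theorem u_inj {m n : ℕ} (hm : m < W.p) (hn : n < W.p) (h : W.u m = W.u n) : m = n := by
  have key : ∀ m n : ℕ, m < n → n < W.p → W.u m ≠ W.u n := by
    intro m n hmn hn h
    obtain ⟨k, rfl⟩ := Nat.exists_eq_add_of_lt hmn
    obtain ⟨z, hz⟩ := W.u_step m (k + 1) (by omega)
    rw [← add_assoc, ← h] at hz
    have hd : (W.p : ℤ) ∣ ((k + 1) * W.c : ℕ) := ⟨z, by push_cast at hz ⊢; linarith⟩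
    have hd' : W.p ∣ (k + 1) * W.c := by exact_mod_cast hd
    rcases (Nat.Prime.dvd_mul W.prime).mp hd' with h | h
    · have := Nat.le_of_dvd (by omega) h; omega
    · have := Nat.le_of_dvd W.c_pos h; have := W.two_c; omega
  rcases lt_trichotomy m n with h' | h' | h'
  · exact absurd h (key m n h' hn)
  · exact h'
  · exact absurd h.symm (key n m h' hm)

theorem image_u : (Finset.range W.p).image W.u = Finset.range W.p := by
  apply Finset.eq_of_subset_of_card_le
  · intro v hv
    obtain ⟨m, hm, rfl⟩ := Finset.mem_image.mp hv
    exact Finset.mem_range.mpr (W.u_lt m (Finset.mem_range.mp hm))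
  · rw [Finset.card_image_of_injOn]
    intro m hm n hn h
    exact W.u_inj (by simpa using hm) (by simpa using hn) h

theorem sum_u {M : Type*} [AddCommMonoid M] (f : ℕ → M) :
    ∑ m ∈ Finset.range W.p, f (W.u m) = ∑ v ∈ Finset.range W.p, f v := by
  conv_rhs => rw [← W.image_u]
  rw [Finset.sum_image]
  intro m hm n hn h
  exact W.u_inj (by simpa using hm) (by simpa using hn) h

theorem card_rows {lo hi : ℕ} (h : hi ≤ W.p) :
    ((Finset.range W.p).filter fun m => lo ≤ W.u m ∧ W.u m < hi).card = hi - lo := by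
  rw [Finset.card_filter, W.sum_u fun v => if lo ≤ v ∧ v < hi then 1 else 0,
    ← Finset.card_filter, ← Nat.card_Ico]
  congr 1
  ext v
  simp only [Finset.mem_filter, Finset.mem_range, Finset.mem_Ico]
  omega

theorem exists_row {v : ℕ} (h : v < W.p) : ∃ m < W.p, W.u m = v := by
  have : v ∈ (Finset.range W.p).image W.u := by rw [W.image_u]; simpa using h
  simpa using this

theorem rowMax_bounds {m : ℕ} (hm : m < W.p) :
    rowMax W.l W.r (W.u m) - 1 ≤ diffTwo W.p W.l W.r W.s (W.x m) (W.y m) ∧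
      diffTwo W.p W.l W.r W.s (W.x m) (W.y m) ≤ rowMax W.l W.r (W.u m) := by
  obtain ⟨z, hz⟩ := W.sum m hm
  exact diffTwo_le_rowMax W.s_nonneg W.s_lt (W.x_nonneg m hm) (W.x_lt m hm) (W.y_nonneg m hm)
    (W.y_lt m hm) W.two_l W.two_r (W.u_lt m hm) hz

/-- Every row is visited once, so the row maxima contribute min(l, r) from the bottom rows and p - l
- r from the top rows, that is p - max(l, r). Each exceptional index costs exactly one. -/
theorem total_eq : W.total = W.p - max W.l W.r - W.exc.card := by
  have h1 : ∀ m ∈ Finset.range W.p, diffTwo W.p W.l W.r W.s (W.x m) (W.y m) =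
      rowMax W.l W.r (W.u m) - if diffTwo W.p W.l W.r W.s (W.x m) (W.y m) ≠
        rowMax W.l W.r (W.u m) then 1 else 0 := by
    intro m hm
    have := W.rowMax_bounds (Finset.mem_range.mp hm)
    split_ifs with h
    · omega
    · push Not at h; omega
  rw [total, Finset.sum_congr rfl h1, Finset.sum_sub_distrib, W.sum_u fun v => rowMax W.l W.r v]
  have h2 : ∑ v ∈ Finset.range W.p, rowMax W.l W.r v = W.p - max W.l W.r := by
    unfold rowMax
    rw [Finset.sum_ite, Finset.sum_const_zero, add_zero, Finset.sum_const, nsmul_eq_mul, mul_one]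
    have : (Finset.range W.p).filter (fun v => v < min W.l W.r ∨ W.l + W.r ≤ v) =
        Finset.Ico 0 (min W.l W.r) ∪ Finset.Ico (W.l + W.r) W.p := by
      ext v
      have := W.two_l
      have := W.two_r
      simp only [Finset.mem_filter, Finset.mem_range, Finset.mem_Ico, Finset.mem_union]
      omega
    rw [this, Finset.card_union_of_disjoint, Nat.card_Ico, Nat.card_Ico]
    · have := W.two_l
      have := W.two_r
      omega
    · rw [Finset.disjoint_left]
      intro v hv hv'
      simp only [Finset.mem_Ico] at hv hv'
      omega
  rw [h2]
  congr 1
  rw [exc, Finset.card_filter]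
  push_cast
  refine Finset.sum_congr rfl fun m _ => ?_
  congr

theorem top {m : ℕ} (hm : m < W.p) (he : m ∉ W.exc) (hu : W.l + W.r ≤ W.u m) :
    W.x m < W.l ∧ W.y m < W.r ∧ W.x m + W.y m + W.u m = W.s + W.l + W.r := by
  obtain ⟨z, hz⟩ := W.sum m hm
  rw [mem_exc] at he
  exact top_row_maximal W.s_nonneg W.s_lt (W.x_nonneg m hm) (W.x_lt m hm) (W.y_nonneg m hm)
    (W.y_lt m hm) W.two_l W.two_r (W.u_lt m hm) hz hu (by tauto)

/-- At an unexceptional point of a row which is not at the bottom the two coordinates are small as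
soon as their sum is the expected one. -/
theorem upper {m : ℕ} (hm : m < W.p) (he : m ∉ W.exc) (hu : max W.l W.r ≤ W.u m)
    (h : W.x m + W.y m + W.u m = W.s + W.l + W.r) : W.x m < W.l ∧ W.y m < W.r := by
  by_cases hu' : W.l + W.r ≤ W.u m
  · have := W.top hm he hu'; tauto
  · rw [mem_exc] at he
    exact middle_row_maximal W.two_l W.two_r h hu (by omega) (by tauto)

theorem bottom {m : ℕ} (hm : m < W.p) (he : m ∉ W.exc) (hu : W.u m < min W.l W.r) :
    (W.x m + W.y m + W.u m = W.s + W.l + W.r - W.p ∧ (W.x m < W.l ∨ W.y m < W.r)) ∨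
      (W.x m + W.y m + W.u m = W.s + W.l + W.r ∧ W.l ≤ W.x m ∧ W.r ≤ W.y m) := by
  obtain ⟨z, hz⟩ := W.sum m hm
  rw [mem_exc] at he
  exact bottom_row_maximal W.s_nonneg W.s_lt (W.x_nonneg m hm) (W.x_lt m hm) (W.y_nonneg m hm)
    (W.y_lt m hm) W.two_l W.two_r (W.u_lt m hm) hz hu (by tauto)

/-- `k` steps of the walk move the first coordinate by less than `l`, the second one by less than
`r`, and their sum by `t`. -/
def Box (k : ℕ) (t : ℝ) : Prop :=
  ∃ A B : ℝ, |A| < W.l ∧ |B| < W.r ∧ A + B = t ∧ (∃ z : ℤ, k * W.a = A + W.p * z) ∧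
    ∃ z : ℤ, k * (W.c - W.a) = B + W.p * z

/-- Both points lie in the rectangle [0, l) × [0, r) and have the sum prescribed by their row, so
their difference is a small representative of the displacement. -/
theorem box_of_pair {m k : ℕ} (h : m + k < W.p) (h1 : m ∉ W.exc) (h2 : m + k ∉ W.exc)
    (hu : W.l + W.r ≤ W.u m) (hu' : W.l + W.r ≤ W.u (m + k)) :
    W.Box k (W.u m - W.u (m + k)) := by
  obtain ⟨a1, a2, a3⟩ := W.top (by omega) h1 hu
  obtain ⟨b1, b2, b3⟩ := W.top h h2 hu'
  have := W.x_nonneg m (by omega)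
  have := W.y_nonneg m (by omega)
  have := W.x_nonneg (m + k) h
  have := W.y_nonneg (m + k) h
  refine ⟨W.x (m + k) - W.x m, W.y (m + k) - W.y m, ?_, ?_, by linarith, ?_, ?_⟩
  · rw [abs_lt]; constructor <;> linarith
  · rw [abs_lt]; constructor <;> linarith
  · obtain ⟨z, hz⟩ := W.x_step m k h
    exact ⟨-z, by rw [hz]; push_cast; ring⟩
  · obtain ⟨z, hz⟩ := W.y_step m k h
    exact ⟨-z, by rw [hz]; push_cast; ring⟩

end CircleWalk

/-! ### Counting visits to rows and pairs of indices. -/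

/-- A bound for the number of visits to `n` given rows within `k` consecutive steps of length `c`
on a circle of length `p`. -/
def visitBound (p c k n : ℕ) : ℕ := min k ((n + c - 1) / c + (k - p / c))

theorem card_le_of_pairs {E S : Finset ℕ} {k : ℕ} (h : ∀ m ∈ S, m ∈ E ∨ m + k ∈ E)
    (h' : ∀ m ∈ S, m + k ∉ S) : S.card ≤ E.card := by
  classical
  apply Finset.card_le_card_of_injOn (fun m => if m ∈ E then m else m + k)
  · intro m hm
    have := h m hm
    simp only [Finset.mem_coe] at hm ⊢
    split_ifs <;> tauto
  · intro m hm n hn hmn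
    simp only [Finset.mem_coe] at hm hn
    simp only at hmn
    split_ifs at hmn
    · exact hmn
    · subst hmn; exact absurd hm (h' n hn)
    · subst hmn; exact absurd hn (h' m hm)
    · omega

/-- An exceptional index can serve at most two pairs, once as first and once as second member. -/
theorem card_le_two_mul_of_pairs {E S : Finset ℕ} {k : ℕ} (h : ∀ m ∈ S, m ∈ E ∨ m + k ∈ E) :
    S.card ≤ 2 * E.card := by
  classical
  have : S ⊆ E ∪ E.image (fun m => m - k) := by
    intro m hm
    rcases h m hm with h | h
    · exact Finset.mem_union_left _ h
    · exact Finset.mem_union_right _ (Finset.mem_image.mpr ⟨_, h, by omega⟩)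
  have h1 := Finset.card_le_card this
  have h2 := Finset.card_union_le E (E.image (fun m => m - k))
  have h3 := Finset.card_image_le (s := E) (f := fun m => m - k)
  omega

namespace CircleWalk

variable (W : CircleWalk)

/-- During at most ⌊p/c⌋ consecutive indices the rows stay at distance at least c from each other,
so each interval of c rows is met at most once. Any further steps are counted trivially. -/
theorem card_visits_le {i k lo hi : ℕ} (hk : i + k ≤ W.p) :
    ((Finset.Ico i (i + k)).filter fun m => lo ≤ W.u m ∧ W.u m < hi).card ≤
      visitBound W.p W.c k (hi - lo) := by
  have hc := W.c_pos
  have block : ∀ k', i + k' ≤ W.p → k' ≤ W.p / W.c →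
      ((Finset.Ico i (i + k')).filter fun m => lo ≤ W.u m ∧ W.u m < hi).card ≤
        (hi - lo + W.c - 1) / W.c := by
    intro k' hk' hkc
    rw [← Finset.card_range ((hi - lo + W.c - 1) / W.c)]
    have hkc' : k' * W.c ≤ W.p := (Nat.le_div_iff_mul_le hc).mp hkc
    apply Finset.card_le_card_of_injOn (fun m => (W.u m - lo) / W.c)
    · intro m hm
      simp only [Finset.coe_filter, Finset.mem_Ico, Set.mem_ofPred_eq] at hm
      simp only [Finset.coe_range, Set.mem_Iio]
      rw [Nat.div_lt_iff_lt_mul hc]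
      have h1 := Nat.div_add_mod (hi - lo + W.c - 1) W.c
      have h2 := Nat.mod_lt (hi - lo + W.c - 1) hc
      rw [mul_comm] at h1
      omega
    · have key : ∀ m n : ℕ, m < n → i ≤ m → n < i + k' → lo ≤ W.u m → lo ≤ W.u n →
          (W.u m - lo) / W.c ≠ (W.u n - lo) / W.c := by
        intro m n hmn him hn hm' hn' h
        obtain ⟨d, rfl⟩ := Nat.exists_eq_add_of_lt hmn
        obtain ⟨z, hz⟩ := W.u_step m (d + 1) (by omega)
        rw [← add_assoc] at hz
        have h1 := Nat.div_add_mod (W.u m - lo) W.c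
        have h2 := Nat.mod_lt (W.u m - lo) hc
        have h3 := Nat.div_add_mod (W.u (m + d + 1) - lo) W.c
        have h4 := Nat.mod_lt (W.u (m + d + 1) - lo) hc
        rw [h] at h1
        have h5 : W.u m < W.u (m + d + 1) + W.c := by omega
        have h6 : W.u (m + d + 1) < W.u m + W.c := by omega
        have h7 : (d + 2) * W.c ≤ k' * W.c := Nat.mul_le_mul_right _ (by omega)
        have h8 : (d + 2) * W.c ≤ W.p := h7.trans hkc'
        zify at h5 h6 h8 hc
        push_cast at hz
        have hdc : 0 ≤ (d : ℤ) * W.c := by positivity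
        rcases lt_trichotomy z 0 with hz0 | hz0 | hz0
        · nlinarith [show (z : ℤ) ≤ -1 by omega, W.p_pos]
        · subst hz0; nlinarith
        · nlinarith [show (1 : ℤ) ≤ z by omega, W.p_pos]
      intro m hm n hn hmn
      simp only [Finset.coe_filter, Finset.mem_Ico, Set.mem_ofPred_eq] at hm hn
      rcases lt_trichotomy m n with h | h | h
      · exact absurd hmn (key m n h hm.1.1 hn.1.2 hm.2.1 hn.2.1)
      · exact h
      · exact absurd hmn.symm (key n m h hn.1.1 hm.1.2 hn.2.1 hm.2.1)
  refine le_min ?_ ?_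
  · refine (Finset.card_filter_le _ _).trans ?_
    simp
  · by_cases hkc : k ≤ W.p / W.c
    · exact (block k hk hkc).trans (Nat.le_add_right _ _)
    · have h1 := block (W.p / W.c) (by omega) le_rfl
      have h2 : (Finset.Ico i (i + k)).filter (fun m => lo ≤ W.u m ∧ W.u m < hi) ⊆
          (Finset.Ico i (i + W.p / W.c)).filter (fun m => lo ≤ W.u m ∧ W.u m < hi) ∪
            Finset.Ico (i + W.p / W.c) (i + k) := by
        intro m hm
        simp only [Finset.mem_filter, Finset.mem_Ico, Finset.mem_union] at hm ⊢
        omega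
      have h3 := Finset.card_le_card h2
      have h4 := Finset.card_union_le
        ((Finset.Ico i (i + W.p / W.c)).filter (fun m => lo ≤ W.u m ∧ W.u m < hi))
        (Finset.Ico (i + W.p / W.c) (i + k))
      rw [Nat.card_Ico] at h4
      omega

theorem le_card_forward {k lo hi : ℕ} (hk : k ≤ W.p) (h : hi ≤ W.p) :
    hi - lo ≤ ((Finset.range (W.p - k)).filter fun m => lo ≤ W.u m ∧ W.u m < hi).card +
      visitBound W.p W.c k (hi - lo) := by
  rw [← W.card_rows (lo := lo) h]
  have h1 : (Finset.range W.p).filter (fun m => lo ≤ W.u m ∧ W.u m < hi) ⊆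
      (Finset.range (W.p - k)).filter (fun m => lo ≤ W.u m ∧ W.u m < hi) ∪
        (Finset.Ico (W.p - k) (W.p - k + k)).filter (fun m => lo ≤ W.u m ∧ W.u m < hi) := by
    intro m hm
    simp only [Finset.mem_filter, Finset.mem_Ico, Finset.mem_union, Finset.mem_range] at hm ⊢
    omega
  refine (Finset.card_le_card h1).trans ((Finset.card_union_le _ _).trans ?_)
  rw [W.card_rows h]
  exact Nat.add_le_add_left (W.card_visits_le (by omega)) _

theorem le_card_backward {k lo hi : ℕ} (hk : k ≤ W.p) (h : hi ≤ W.p) :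
    hi - lo ≤ ((Finset.range (W.p - k)).filter fun m => lo ≤ W.u (m + k) ∧ W.u (m + k) < hi).card +
      visitBound W.p W.c k (hi - lo) := by
  rw [← W.card_rows (lo := lo) h]
  have h1 : (Finset.range W.p).filter (fun m => lo ≤ W.u m ∧ W.u m < hi) ⊆
      ((Finset.range (W.p - k)).filter fun m => lo ≤ W.u (m + k) ∧ W.u (m + k) < hi).image (· + k) ∪
        (Finset.Ico 0 (0 + k)).filter (fun m => lo ≤ W.u m ∧ W.u m < hi) := by
    intro m hm
    simp only [Finset.mem_filter, Finset.mem_Ico, Finset.mem_union, Finset.mem_range,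
      Finset.mem_image] at hm ⊢
    by_cases hmk : m < k
    · right; omega
    · left
      exact ⟨m - k, by rw [Nat.sub_add_cancel (by omega)]; omega, by omega⟩
  refine (Finset.card_le_card h1).trans ((Finset.card_union_le _ _).trans ?_)
  rw [W.card_rows h]
  exact Nat.add_le_add Finset.card_image_le (W.card_visits_le (by omega))

end CircleWalk

/-! ### Extremal walks, the window and the existence of boxes. -/

namespace CircleWalk

variable (W : CircleWalk)

/-- The numbers s + l + r - u are congruent to distinct translates of s by integers, and a half-open
interval of length l + r contains only l + r such translates. Taking the floor of s makes this a
count of integers. -/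
theorem card_window (T : Finset ℕ)
    (h : ∀ m ∈ T, m < W.p ∧ ∃ j : ℤ, 0 ≤ W.s + W.l + W.r - W.u m + W.p * j ∧
      W.s + W.l + W.r - W.u m + W.p * j < W.l + W.r) : T.card ≤ W.l + W.r := by
  choose! hp j hj using h
  have hfl : ∀ m ∈ T, 0 ≤ ⌊W.s⌋ + W.l + W.r - W.u m + W.p * j m ∧
      ⌊W.s⌋ + W.l + W.r - W.u m + W.p * j m < W.l + W.r := by
    intro m hm
    obtain ⟨h1, h2⟩ := hj m hm
    have e : ⌊W.s + ((W.l + W.r - W.u m + W.p * j m : ℤ) : ℝ)⌋ =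
        ⌊W.s⌋ + (W.l + W.r - W.u m + W.p * j m) := Int.floor_add_intCast _ _
    push_cast at e
    constructor
    · have : 0 ≤ ⌊W.s + (W.l + W.r - W.u m + W.p * j m : ℝ)⌋ := Int.floor_nonneg.mpr (by linarith)
      omega
    · have : ⌊W.s + (W.l + W.r - W.u m + W.p * j m : ℝ)⌋ < W.l + W.r := by
        rw [Int.floor_lt]; push_cast; linarith
      omega
  rw [← Finset.card_range (W.l + W.r)]
  apply Finset.card_le_card_of_injOn
    (fun m => (⌊W.s⌋ + W.l + W.r - W.u m + W.p * j m).toNat)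
  · intro m hm
    have := hfl m hm
    simp only [Finset.coe_range, Set.mem_Iio]
    omega
  · intro m hm n hn hmn
    have h1 := hfl m hm
    have h2 := hfl n hn
    simp only at hmn
    have h3 : (W.u m : ℤ) = W.u n + W.p * (j m - j n) := by
      have : ⌊W.s⌋ + W.l + W.r - W.u m + W.p * j m = ⌊W.s⌋ + W.l + W.r - W.u n + W.p * j n := by
        omega
      linarith
    have a1 := W.u_lt m (hp m hm)
    have a2 := W.u_lt n (hp n hn)
    refine W.u_inj (hp m hm) (hp n hn) ?_
    have h4 : (W.u m : ℝ) = W.u n + W.p * ((j m - j n : ℤ) : ℝ) := by exact_mod_cast h3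
    have := eq_of_congr (by positivity) (by exact_mod_cast a1) (by positivity)
      (by exact_mod_cast a2) h4
    exact_mod_cast this

/-- The unexceptional indices in the rows from `lo` to `hi`. -/
noncomputable def reg (lo hi : ℕ) : Finset ℕ :=
  ((Finset.range W.p).filter fun m => lo ≤ W.u m ∧ W.u m < hi) \ W.exc

theorem mem_reg {lo hi m : ℕ} :
    m ∈ W.reg lo hi ↔ (m < W.p ∧ lo ≤ W.u m ∧ W.u m < hi) ∧ m ∉ W.exc := by
  simp [reg]

theorem le_card_reg {lo hi : ℕ} (h : hi ≤ W.p) :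
    hi - lo ≤ (W.reg lo hi).card + W.exc.card := by
  have := Finset.le_card_sdiff W.exc
    ((Finset.range W.p).filter fun m => lo ≤ W.u m ∧ W.u m < hi)
  rw [W.card_rows h] at this
  unfold reg
  omega

/-- The walk is extremal if its total exceeds `2 p / 3`. -/
def Extremal : Prop := 2 * (W.p : ℤ) < 3 * W.total

variable {W}

theorem swap_total : W.swap.total = W.total := by
  unfold total; simp only [swap, diffTwo_comm]

theorem Extremal.swap (h : W.Extremal) : W.swap.Extremal := by
  unfold Extremal at h ⊢
  rw [swap_total]; exact h

theorem Extremal.exc_card (h : W.Extremal) :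
    3 * W.exc.card + 3 * max W.l W.r + 1 ≤ W.p := by
  unfold Extremal at h
  rw [total_eq] at h
  omega

/-- The p - l - r top rows, up to exceptions, fit into a window of l + r rows; `Extremal.exc_card`
then eliminates the number of exceptions. -/
theorem Extremal.le (h : W.Extremal) : 2 * W.p + 1 ≤ 6 * min W.l W.r + 3 * max W.l W.r := by
  have h1 := W.card_window (W.reg (W.l + W.r) W.p) fun m hm => by
    rw [mem_reg] at hm
    refine ⟨hm.1.1, 0, ?_⟩
    obtain ⟨a1, a2, a3⟩ := W.top hm.1.1 hm.2 hm.1.2.1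
    have := W.x_nonneg m hm.1.1
    have := W.y_nonneg m hm.1.1
    push_cast
    constructor <;> linarith
  have h2 := W.le_card_reg (lo := W.l + W.r) le_rfl
  have h3 := W.two_l
  have h4 := W.two_r
  unfold Extremal at h
  rw [total_eq] at h
  omega

theorem Box.swap {k : ℕ} {t : ℝ} (h : W.Box k t) : W.swap.Box k t := by
  obtain ⟨A, B, hA, hB, hAB, ⟨z, hz⟩, hB'⟩ := h
  refine ⟨B, A, hB, hA, by linarith, hB', z, ?_⟩
  simp only [CircleWalk.swap]
  linarith

theorem u_eq_of_congr {m k : ℕ} (h : m + k < W.p) {t z : ℤ} (ht : (k * W.c : ℤ) = t + W.p * z)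
    (h0 : t ≤ W.u m) (h1 : W.u m - t < W.p) : (W.u (m + k) : ℤ) = W.u m - t := by
  obtain ⟨w, hw⟩ := W.u_step m k h
  have a := W.u_lt _ h
  have : (W.u (m + k) : ℝ) = ((W.u m - t : ℤ) : ℝ) + W.p * ((w - z : ℤ) : ℝ) := by
    have : (W.u (m + k) : ℤ) = (W.u m - t) + W.p * (w - z) := by rw [hw, ht]; ring
    exact_mod_cast this
  have := eq_of_congr (by positivity) (by exact_mod_cast a) (by exact_mod_cast sub_nonneg.mpr h0)
    (by exact_mod_cast h1) this
  exact_mod_cast this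

theorem u_eq_of_wrap {m k : ℕ} (h : m + k < W.p) (h0 : W.p ≤ W.u (m + k) + k * W.c)
    (h1 : W.u (m + k) + k * W.c < 2 * W.p) : W.u m + W.p = W.u (m + k) + k * W.c := by
  obtain ⟨w, hw⟩ := W.u_step m k h
  have hlt := W.u_lt m (by omega)
  have h0' : (W.p : ℝ) ≤ W.u (m + k) + k * W.c := by exact_mod_cast h0
  have h1' : (W.u (m + k) + k * W.c : ℝ) < 2 * W.p := by exact_mod_cast h1
  have e : (W.u m : ℝ) = (W.u (m + k) + k * W.c - W.p) + W.p * ((1 - w : ℤ) : ℝ) := by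
    have : (W.u m : ℤ) = (W.u (m + k) + k * W.c - W.p) + W.p * (1 - w) := by rw [hw]; ring
    exact_mod_cast this
  have := eq_of_congr (by positivity) (by exact_mod_cast hlt) (by linarith) (by linarith) e
  have : (W.u m : ℝ) + W.p = W.u (m + k) + k * W.c := by linarith
  exact_mod_cast this

/-- A box exists as soon as there are many pairs of indices in the top rows. -/
theorem exists_box {k : ℕ} (hk : k ≤ W.p) {t z : ℤ} (ht : (k * W.c : ℤ) = t + W.p * z) {lo hi : ℕ}
    (hlo : (W.l + W.r : ℤ) ≤ lo) (hlo' : W.l + W.r + t ≤ lo) (hhi : hi ≤ W.p)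
    (hhi' : (hi : ℤ) ≤ W.p + t)
    (hcard : 2 * W.exc.card + visitBound W.p W.c k (hi - lo) < hi - lo) : W.Box k t := by
  have h1 := W.le_card_forward (lo := lo) hk hhi
  by_contra hb
  have h2 := card_le_two_mul_of_pairs (E := W.exc) (k := k)
    -- The bounds on `lo` and `hi` put both rows u and u - t in the top part. Without a box, every
    -- such pair must contain an exceptional index.
    (S := (Finset.range (W.p - k)).filter fun m => lo ≤ W.u m ∧ W.u m < hi) (by
      intro m hm
      simp only [Finset.mem_filter, Finset.mem_range] at hm
      by_contra hne
      push Not at hne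
      have hmk : m + k < W.p := by omega
      have hu := u_eq_of_congr hmk ht (by omega) (by omega)
      apply hb
      have := W.box_of_pair hmk hne.1 hne.2 (by omega) (by omega)
      have e : (t : ℝ) = W.u m - W.u (m + k) := by
        have : t = W.u m - W.u (m + k) := by omega
        rw [this]; push_cast; rfl
      rwa [e])
  omega

/-! ### Halving a box: the half turn. -/

section Parity

variable {k m : ℕ} {A B : ℝ}

/-- From an unexceptional top point, x advances by about p/2 and y by B/2 ≥ 0, neither passing p.
The sum at the endpoint is therefore the expected one and `upper` demands x < l there, but x is at
least (A + p)/2 > (p - l)/2 > l. -/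
theorem mem_exc_forward (h3 : 3 * max W.l W.r < W.p) (hA : |A| < W.l) (hB : |B| < W.r)
    (hAB : A + B = 2 * k * W.c - W.p) (ha : ∃ z : ℤ, k * W.a = (A + W.p) / 2 + W.p * z)
    (hb : ∃ z : ℤ, k * (W.c - W.a) = B / 2 + W.p * z) (hB0 : 0 ≤ B) (hm : m + k < W.p)
    (hk : min W.l W.r ≤ k * W.c) (hu : k * W.c + max W.l W.r ≤ W.u m) :
    m ∈ W.exc ∨ m + k ∈ W.exc := by
  by_contra hne
  push Not at hne
  have hm' : m < W.p := by omega
  have h3l : 3 * (W.l : ℝ) < W.p := by exact_mod_cast (by omega : 3 * W.l < W.p)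
  have h3r : 3 * (W.r : ℝ) < W.p := by exact_mod_cast (by omega : 3 * W.r < W.p)
  obtain ⟨t1, t2, t3⟩ := W.top hm' hne.1 (by omega)
  have x0 := W.x_nonneg m hm'
  have y0 := W.y_nonneg m hm'
  obtain ⟨z1, hz1⟩ := W.x_step m k hm
  obtain ⟨z2, hz2⟩ := W.y_step m k hm
  obtain ⟨w1, hw1⟩ := ha
  obtain ⟨w2, hw2⟩ := hb
  rw [abs_lt] at hA hB
  have hx : W.x (m + k) = W.x m + (A + W.p) / 2 := by
    refine eq_of_congr (W.x_nonneg _ hm) (W.x_lt _ hm) (by linarith) (by linarith)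
      (z := z1 + w1) ?_
    rw [hz1, hw1]; push_cast; ring
  have hy : W.y (m + k) = W.y m + B / 2 := by
    refine eq_of_congr (W.y_nonneg _ hm) (W.y_lt _ hm) (by linarith) (by linarith)
      (z := z2 + w2) ?_
    rw [hz2, hw2]; push_cast; ring
  have hlt := W.u_lt m hm'
  have hu1 : (W.u (m + k) : ℤ) = W.u m - k * W.c :=
    u_eq_of_congr hm (t := k * W.c) (z := 0) (by ring) (by zify at hu; omega)
      (by have : (0 : ℤ) ≤ k * W.c := by positivity
          omega)
  have hu2 : (W.u (m + k) : ℝ) = W.u m - k * W.c := by exact_mod_cast hu1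
  have := W.upper hm hne.2 (by zify; rw [hu1]; zify at hu; linarith) (by
    rw [hx, hy, hu2]; linarith)
  linarith

/-- The same argument traversed from m + k back to m: the complementary half turn (p - A)/2 and the
shift -B/2 are both nonnegative when B ≤ 0. -/
theorem mem_exc_backward (h3 : 3 * max W.l W.r < W.p) (hA : |A| < W.l) (hB : |B| < W.r)
    (hAB : A + B = 2 * k * W.c - W.p) (ha : ∃ z : ℤ, k * W.a = (A + W.p) / 2 + W.p * z)
    (hb : ∃ z : ℤ, k * (W.c - W.a) = B / 2 + W.p * z) (hB0 : B ≤ 0) (hm : m + k < W.p)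
    (hk : k * W.c + min W.l W.r ≤ W.p) (hu : W.p + max W.l W.r ≤ W.u (m + k) + k * W.c) :
    m ∈ W.exc ∨ m + k ∈ W.exc := by
  by_contra hne
  push Not at hne
  have hm' : m < W.p := by omega
  have h3l : 3 * (W.l : ℝ) < W.p := by exact_mod_cast (by omega : 3 * W.l < W.p)
  have h3r : 3 * (W.r : ℝ) < W.p := by exact_mod_cast (by omega : 3 * W.r < W.p)
  obtain ⟨t1, t2, t3⟩ := W.top hm hne.2 (by omega)
  have x0 := W.x_nonneg _ hm
  have y0 := W.y_nonneg _ hm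
  obtain ⟨z1, hz1⟩ := W.x_step m k hm
  obtain ⟨z2, hz2⟩ := W.y_step m k hm
  obtain ⟨w1, hw1⟩ := ha
  obtain ⟨w2, hw2⟩ := hb
  rw [abs_lt] at hA hB
  have hx : W.x m = W.x (m + k) + (W.p - A) / 2 := by
    refine eq_of_congr (W.x_nonneg _ hm') (W.x_lt _ hm') (by linarith) (by linarith)
      (z := - z1 - w1 - 1) ?_
    rw [hz1, hw1]; push_cast; ring
  have hy : W.y m = W.y (m + k) - B / 2 := by
    refine eq_of_congr (W.y_nonneg _ hm') (W.y_lt _ hm') (by linarith) (by linarith)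
      (z := - z2 - w2) ?_
    rw [hz2, hw2]; push_cast; ring
  have hlt := W.u_lt m hm'
  have hlt2 := W.u_lt _ hm
  have hu2 : W.u m + W.p = W.u (m + k) + k * W.c := u_eq_of_wrap hm (by omega) (by omega)
  have hu1 : (W.u m : ℝ) = W.u (m + k) + k * W.c - W.p := by
    have : (W.u m : ℝ) + W.p = W.u (m + k) + k * W.c := by exact_mod_cast hu2
    linarith
  have := W.upper hm' hne.1 (by omega) (by
    rw [hx, hy, hu1]; linarith)
  linarith

end Parity

variable (W) in
/-- Half of a double box in which the first coordinate makes the additional half turn. -/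
def HalfTurn (k : ℕ) : Prop :=
  ∃ A B : ℝ, |A| < W.l ∧ |B| < W.r ∧ A + B = 2 * k * W.c - W.p ∧
    (∃ z : ℤ, k * W.a = (A + W.p) / 2 + W.p * z) ∧ ∃ z : ℤ, k * (W.c - W.a) = B / 2 + W.p * z

/-- The two winding numbers of a displacement with sum 2kc - p add up to 1. Exactly one is odd, and
halving leaves a half turn in that coordinate. -/
theorem Box.halfTurn {k : ℕ} (hbox : W.Box (2 * k) (2 * k * W.c - W.p)) :
    W.HalfTurn k ∨ W.swap.HalfTurn k := by
  obtain ⟨A, B, hA, hB, hAB, ⟨z1, hz1⟩, z2, hz2⟩ := hbox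
  push_cast at hz1 hz2
  have hp : (0 : ℝ) < W.p := by exact_mod_cast W.p_pos
  have hz : z1 + z2 = 1 := by
    have : (W.p : ℝ) * (z1 + z2) = W.p * 1 := by linarith
    exact_mod_cast mul_left_cancel₀ hp.ne' this
  rcases Int.even_or_odd' z1 with ⟨w, hw | hw⟩
  · right
    have hz2' : z2 = 2 * (-w) + 1 := by omega
    rw [hw] at hz1
    rw [hz2'] at hz2
    push_cast at hz1 hz2
    refine ⟨B, A, hB, hA, by simp only [CircleWalk.swap]; linarith, ⟨-w, ?_⟩, ⟨w, ?_⟩⟩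
    · simp only [CircleWalk.swap]; push_cast; linarith
    · simp only [CircleWalk.swap]; linarith
  · left
    have hz2' : z2 = 2 * (-w) := by omega
    rw [hw] at hz1
    rw [hz2'] at hz2
    push_cast at hz1 hz2
    exact ⟨A, B, hA, hB, hAB, ⟨w, by linarith⟩, ⟨-w, by push_cast; linarith⟩⟩

/-- After a half turn of the first coordinate one leaves the box. -/
theorem HalfTurn.false {k h1 h2 : ℕ} (h : W.HalfTurn k) (h3 : 3 * max W.l W.r < W.p)
    (hkp : k ≤ W.p) (hk : min W.l W.r ≤ k * W.c) (hk' : k * W.c + min W.l W.r ≤ W.p)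
    (hh1 : h1 ≤ W.p) (hd1 : h1 ≤ 2 * (k * W.c) + max W.l W.r)
    (hc1 : W.exc.card + visitBound W.p W.c k (h1 - (k * W.c + max W.l W.r)) <
      h1 - (k * W.c + max W.l W.r))
    (hh2 : h2 ≤ W.p) (hd2 : h2 + 2 * (k * W.c) ≤ 2 * W.p + max W.l W.r)
    (hc2 : W.exc.card + visitBound W.p W.c k (h2 - (W.p + max W.l W.r - k * W.c)) <
      h2 - (W.p + max W.l W.r - k * W.c)) : False := by
  obtain ⟨A, B, hA, hB, hAB, ha, hb⟩ := h
  -- The sign of B decides the direction of travel. In either direction the upper end of the row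
  -- interval is chosen so that k steps leave the interval, which makes the pairs disjoint and
  -- avoids the factor two.
  rcases le_total 0 B with hB0 | hB0
  · have n1 := W.le_card_forward (lo := k * W.c + max W.l W.r) hkp hh1
    have n2 := card_le_of_pairs (E := W.exc) (k := k)
      (S := (Finset.range (W.p - k)).filter fun m => k * W.c + max W.l W.r ≤ W.u m ∧ W.u m < h1)
      (by
        intro m hm
        simp only [Finset.mem_filter, Finset.mem_range] at hm
        exact mem_exc_forward h3 hA hB hAB ha hb hB0 (by omega) hk hm.2.1)
      (by
        intro m hm hm'
        simp only [Finset.mem_filter, Finset.mem_range] at hm hm'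
        have := W.u_lt m (by omega)
        have := u_eq_of_congr (W := W) (m := m) (k := k) (by omega) (t := k * W.c) (z := 0)
          (by ring) (by have := hm.2.1; zify at this; omega)
          (by have : (0 : ℤ) ≤ k * W.c := by positivity
              omega)
        have := hm'.2.1
        zify at *
        omega)
    omega
  · have n1 := W.le_card_backward (lo := W.p + max W.l W.r - k * W.c) hkp hh2
    have n2 := card_le_of_pairs (E := W.exc) (k := k)
      (S := (Finset.range (W.p - k)).filter fun m =>
        W.p + max W.l W.r - k * W.c ≤ W.u (m + k) ∧ W.u (m + k) < h2)
      (by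
        intro m hm
        simp only [Finset.mem_filter, Finset.mem_range] at hm
        exact mem_exc_backward h3 hA hB hAB ha hb hB0 (by omega) hk' (by omega))
      (by
        intro m hm hm'
        simp only [Finset.mem_filter, Finset.mem_range] at hm hm'
        have hlt := W.u_lt (m + k + k) (by omega)
        have hlt' := W.u_lt (m + k) (by omega)
        have e := u_eq_of_wrap (W := W) (m := m + k) (k := k) (by omega) (by omega) (by omega)
        omega)
    omega

theorem parity_contradiction {k h1 h2 : ℕ} (hbox : W.Box (2 * k) (2 * k * W.c - W.p))
    (h3 : 3 * max W.l W.r < W.p) (hkp : k ≤ W.p)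
    (hk : min W.l W.r ≤ k * W.c) (hk' : k * W.c + min W.l W.r ≤ W.p)
    (hh1 : h1 ≤ W.p) (hd1 : h1 ≤ 2 * (k * W.c) + max W.l W.r)
    (hc1 : W.exc.card + visitBound W.p W.c k (h1 - (k * W.c + max W.l W.r)) <
      h1 - (k * W.c + max W.l W.r))
    (hh2 : h2 ≤ W.p) (hd2 : h2 + 2 * (k * W.c) ≤ 2 * W.p + max W.l W.r)
    (hc2 : W.exc.card + visitBound W.p W.c k (h2 - (W.p + max W.l W.r - k * W.c)) <
      h2 - (W.p + max W.l W.r - k * W.c)) : False := by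
  rcases hbox.halfTurn with h | h
  · exact h.false h3 hkp hk hk' hh1 hd1 hc1 hh2 hd2 hc2
  · refine h.false (W := W.swap) (h1 := h1) (h2 := h2) ?_ hkp ?_ ?_ hh1 ?_ ?_ hh2 ?_ ?_ <;>
      (try rw [swap_exc]) <;> simp only [swap] <;> first | rwa [max_comm] | rwa [min_comm]

end CircleWalk

/-! ### Choosing the number of steps. -/

/-- The numerical conditions under which `k` steps of a walk lead to a contradiction. Here `n`
bounds the number of exceptional indices. -/
def Suitable (p al be c n k : ℕ) : Prop :=
  2 * k ≤ p ∧ al ≤ k * c ∧ k * c + al ≤ p ∧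
    (2 * n + visitBound p c (2 * k) (min p (2 * (k * c)) - max (al + be) (al + be + 2 * (k * c) - p))
      < min p (2 * (k * c)) - max (al + be) (al + be + 2 * (k * c) - p)) ∧
    (n + visitBound p c k (min p (2 * (k * c) + be) - (k * c + be)) <
      min p (2 * (k * c) + be) - (k * c + be)) ∧
    (n + visitBound p c k (min p (2 * p + be - 2 * (k * c)) - (p + be - k * c)) <
      min p (2 * p + be - 2 * (k * c)) - (p + be - k * c))

instance (p al be c n k : ℕ) : Decidable (Suitable p al be c n k) := by
  unfold Suitable; infer_instance

/-- The list consists of the primes from 11 to 43. The ranges are exhaustive: 3 be < p gives be ≤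
14, and 2k ≤ p gives k ≤ 21. The number of exceptions is taken as large as `Extremal.exc_card`
permits. -/
theorem small_primes_suitable : ∀ p ∈ [11, 13, 17, 19, 23, 29, 31, 37, 41, 43],
    ∀ be ∈ List.range 15, 3 * be < p → ∀ al ∈ List.range (be + 1), 2 * p + 1 ≤ 6 * al + 3 * be →
      ∀ c, c = min (al * be % p) (p - al * be % p) → c = 1 ∨ (3 * c ≤ p + 2 ∧ p ≤ 3 * c + 2) ∨
        ∃ k ∈ List.range 22, Suitable p al be c ((p - 1 - 3 * be) / 3) k := by
  simp only [forall_eq]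
  decide +kernel

/-- For c = 2 and c = 3 a k with kc near p/2 is comparable to p, so the trivial bound k on visits
does not suffice; the separation of the rows by c enters through `visitBound`. -/
theorem suitable_two {p al be n k : ℕ} (hp : 45 ≤ p) (hp2 : p % 2 = 1) (hab : al ≤ be)
    (hn : 3 * n + 3 * be + 1 ≤ p) (hle : 2 * p + 1 ≤ 6 * al + 3 * be) (hk : k = p / 4) :
    Suitable p al be 2 n k := by
  unfold Suitable visitBound
  refine ⟨by omega, by omega, by omega, ?_, ?_, ?_⟩ <;> omega

theorem suitable_three {p al be n k : ℕ} (hp : 45 ≤ p) (hp2 : p % 2 = 1) (hab : al ≤ be)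
    (hn : 3 * n + 3 * be + 1 ≤ p) (hle : 2 * p + 1 ≤ 6 * al + 3 * be) (hk : k = p / 6) :
    Suitable p al be 3 n k := by
  unfold Suitable visitBound
  refine ⟨by omega, by omega, by omega, ?_, ?_, ?_⟩ <;> omega

/-- Here at most k visits in k steps is enough, because kc keeps a distance of k from both p/3 and
2p/3. -/
theorem suitable_of_le {p al be c n k : ℕ} (hk : 0 < k) (hc : 4 ≤ c)
    (hab : al ≤ be) (hn : 3 * n + 3 * be + 1 ≤ p) (hle : 2 * p + 1 ≤ 6 * al + 3 * be)
    (h1 : p + 3 * k ≤ 3 * (k * c)) (h2 : 3 * (k * c) + 3 * k ≤ 2 * p) :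
    Suitable p al be c n k := by
  have hkc : 4 * k ≤ k * c := by nlinarith
  generalize hK : k * c = K at *
  have v1 : ∀ m, visitBound p c k m ≤ k := fun m => min_le_left _ _
  have v2 : ∀ m, visitBound p c (2 * k) m ≤ 2 * k := fun m => min_le_left _ _
  unfold Suitable
  rw [hK]
  refine ⟨by omega, by omega, by omega, (Nat.add_le_add_left (v2 _) _).trans_lt ?_,
    (Nat.add_le_add_left (v1 _) _).trans_lt ?_, (Nat.add_le_add_left (v1 _) _).trans_lt ?_⟩ <;>
    omega

theorem exists_steps {p c : ℕ} (hp : 45 ≤ p) (hc : 4 ≤ c) (h2c : 2 * c < p)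
    (hfar : 3 * c + 3 ≤ p ∨ p + 3 ≤ 3 * c) :
    ∃ k, 0 < k ∧ p + 3 * k ≤ 3 * (k * c) ∧ 3 * (k * c) + 3 * k ≤ 2 * p := by
  by_cases h1 : p + 3 ≤ 3 * c
  · exact ⟨1, by omega⟩
  by_cases h2 : p + 6 ≤ 6 * c
  · exact ⟨2, by omega⟩
  obtain ⟨d, rfl⟩ : ∃ d, c = d + 1 := ⟨c - 1, by omega⟩
  have hd : 0 < 3 * d := by omega
  have a1 := Nat.div_add_mod p (3 * d)
  have a2 := Nat.mod_lt p hd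
  -- This is the least k with 3k(c - 1) > p. For the other inequality 3k(c + 1) ≤ 2p, the overshoot
  -- caused by rounding up is controlled by `key`.
  refine ⟨p / (3 * d) + 1, Nat.succ_pos _, ?_, ?_⟩
  · nlinarith
  · have h3 : 3 * d * (p / (3 * d)) ≤ p := Nat.mul_div_le p (3 * d)
    generalize p / (3 * d) = t at *
    have key : 3 * (d + 2) * d ≤ p * (d - 2) := by
      have h5 : d = 3 ∨ d = 4 ∨ d = 5 ∨ 6 ≤ d := by omega
      rcases h5 with rfl | rfl | rfl | h5
      · omega
      · omega
      · omega
      · obtain ⟨f, rfl⟩ : ∃ f, d = f + 6 := ⟨d - 6, by omega⟩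
        rw [show f + 6 - 2 = f + 4 by omega]
        have : 6 * f + 37 ≤ p := by omega
        nlinarith
    obtain ⟨f, rfl⟩ : ∃ f, d = f + 2 := ⟨d - 2, by omega⟩
    rw [show f + 2 - 2 = f by omega] at key
    have : (f + 2) * (3 * ((t + 1) * (f + 2 + 1)) + 3 * (t + 1)) ≤ (f + 2) * (2 * p) := by
      nlinarith [Nat.mul_le_mul_right (f + 4) h3]
    exact Nat.le_of_mul_le_mul_left this (by omega)

namespace CircleWalk

variable {W : CircleWalk}

theorem Extremal.not_suitable (h : W.Extremal) {n k : ℕ} (hn : W.exc.card ≤ n)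
    (hs : Suitable W.p (min W.l W.r) (max W.l W.r) W.c n k) : False := by
  obtain ⟨h1, h2, h3, h4, h5, h6⟩ := hs
  have e := h.exc_card
  have hlr : min W.l W.r + max W.l W.r = W.l + W.r := min_add_max _ _
  rw [hlr] at h4
  have hbox : W.Box (2 * k) (2 * k * W.c - W.p) := by
    have := exists_box (W := W) (k := 2 * k) (by omega) (t := 2 * (k * W.c : ℕ) - W.p) (z := 1)
      (by push_cast; ring) (lo := max (W.l + W.r) (W.l + W.r + 2 * (k * W.c) - W.p))
      (hi := min W.p (2 * (k * W.c))) (by omega) (by omega) (by omega) (by omega) (by omega)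
    have e : (2 * k * W.c - W.p : ℝ) = ((2 * (k * W.c : ℕ) - W.p : ℤ) : ℝ) := by push_cast; ring
    rwa [e]
  exact parity_contradiction (h1 := min W.p (2 * (k * W.c) + max W.l W.r))
    (h2 := min W.p (2 * W.p + max W.l W.r - 2 * (k * W.c))) hbox (by omega) (by omega) h2 h3
    (min_le_left _ _) (min_le_right _ _) (by omega) (min_le_left _ _) (by omega) (by omega)

/-- Since 2c < p, c is the absolute value of the least absolute residue of lr. -/
theorem c_eq : W.c = min (min W.l W.r * max W.l W.r % W.p)
    (W.p - min W.l W.r * max W.l W.r % W.p) := by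
  rw [min_mul_max]
  have h1 := W.two_c
  have h0 := W.c_pos
  have h2 := Nat.mod_lt (W.l * W.r) W.p_pos
  have h3 := Nat.div_add_mod (W.l * W.r) W.p
  have hp := W.p_pos
  rcases W.rel with ⟨z, hz⟩ | ⟨z, hz⟩
  · have : W.l * W.r % W.p = W.c := by
      have : (W.l * W.r : ℤ) % W.p = W.c := by
        rw [show (W.l * W.r : ℤ) = W.c + W.p * (-z) by linarith, Int.add_mul_emod_self_left]
        exact Int.emod_eq_of_lt (by omega) (by omega)
      exact_mod_cast this
    omega
  · have : W.l * W.r % W.p = W.p - W.c := by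
      have : (W.l * W.r : ℤ) % W.p = W.p - W.c := by
        rw [show (W.l * W.r : ℤ) = (W.p - W.c) + W.p * (z - 1) by linarith,
          Int.add_mul_emod_self_left]
        exact Int.emod_eq_of_lt (by omega) (by omega)
      zify [show W.c ≤ W.p by omega]
      exact_mod_cast this
    omega

theorem Extremal.c_cases (h : W.Extremal) (hp : 11 ≤ W.p) :
    W.c = 1 ∨ (3 * W.c ≤ W.p + 2 ∧ W.p ≤ 3 * W.c + 2) := by
  by_contra hne
  push Not at hne
  have e := h.exc_card
  have le := h.le
  have c0 := W.c_pos
  have hab : min W.l W.r ≤ max W.l W.r := min_le_max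
  have hp2 : W.p % 2 = 1 := by
    rcases W.prime.eq_two_or_odd with h | h <;> omega
  have hp3 : W.p % 3 ≠ 0 := fun h0 => by
    have := (Nat.prime_dvd_prime_iff_eq Nat.prime_three W.prime).mp (Nat.dvd_of_mod_eq_zero h0)
    omega
  by_cases h45 : 45 ≤ W.p
  · by_cases h2 : W.c = 2
    · refine h.not_suitable le_rfl (k := W.p / 4) ?_
      rw [h2]
      exact suitable_two h45 hp2 hab e le rfl
    by_cases h3 : W.c = 3
    · refine h.not_suitable le_rfl (k := W.p / 6) ?_
      rw [h3]
      exact suitable_three h45 hp2 hab e le rfl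
    · obtain ⟨k, k0, k1, k2⟩ := exists_steps h45 (c := W.c) (by omega) W.two_c (by omega)
      exact h.not_suitable le_rfl (suitable_of_le k0 (by omega) hab e le k1 k2)
  · have hmem : W.p ∈ [11, 13, 17, 19, 23, 29, 31, 37, 41, 43] := by
      have hpr := W.prime
      generalize W.p = p at *
      interval_cases p <;> first | (exfalso; revert hpr; norm_num; done) | simp
    rcases small_primes_suitable W.p hmem (max W.l W.r) (by simp only [List.mem_range]; omega) (by omega) (min W.l W.r)
      (by simp only [List.mem_range]; omega) le W.c c_eq with h' | h' | ⟨k, -, hk⟩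
    · exact hne.1 h'
    · omega
    · exact h.not_suitable (by omega) hk

end CircleWalk

/-! ### The case c = 1. -/

namespace CircleWalk

variable {W : CircleWalk}

/-- The same walk with another real representative of the step of the first coordinate. -/
def withStep (W : CircleWalk) (A : ℝ) (z : ℤ) (h : W.a = A + W.p * z) : CircleWalk :=
  { W with
    a := A
    x_step := fun m k hm => by
      obtain ⟨w, hw⟩ := W.x_step m k hm
      exact ⟨w + k * z, by rw [hw, h]; push_cast; ring⟩
    y_step := fun m k hm => by
      obtain ⟨w, hw⟩ := W.y_step m k hm
      exact ⟨w - k * z, by rw [hw, h]; push_cast; ring⟩ }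

/-- The rows in which some index of the top rows is unexceptional are close to `s`. -/
theorem top_bounds {m : ℕ} (hm : m ∈ W.reg (W.l + W.r) W.p) :
    W.s < W.u m ∧ W.u m ≤ W.s + W.l + W.r := by
  rw [mem_reg] at hm
  obtain ⟨h1, h2, h3⟩ := W.top hm.1.1 hm.2 hm.1.2.1
  have := W.x_nonneg m hm.1.1
  have := W.y_nonneg m hm.1.1
  constructor <;> linarith

theorem window_of_top {m : ℕ} (hm : m ∈ W.reg (W.l + W.r) W.p) :
    ∃ j : ℤ, 0 ≤ W.s + W.l + W.r - W.u m + W.p * j ∧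
      W.s + W.l + W.r - W.u m + W.p * j < W.l + W.r := by
  have := top_bounds hm
  refine ⟨0, ?_⟩
  push_cast
  constructor <;> linarith

/-- Among the first e + 1 top rows one is unexceptional, and its row exceeds s. -/
theorem Extremal.s_lt (h : W.Extremal) : W.s < W.l + W.r + W.exc.card := by
  have e := h.exc_card
  have hn := W.le_card_reg (lo := W.l + W.r) (hi := W.l + W.r + W.exc.card + 1) (by omega)
  have : 0 < (W.reg (W.l + W.r) (W.l + W.r + W.exc.card + 1)).card := by omega
  obtain ⟨m, hm⟩ := Finset.card_pos.mp this
  rw [mem_reg] at hm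
  have h1 := top_bounds (W := W) (m := m) (by rw [mem_reg]; exact ⟨⟨hm.1.1, hm.1.2.1,
    W.u_lt m hm.1.1⟩, hm.2⟩)
  have h2 : W.u m ≤ W.l + W.r + W.exc.card := by omega
  have h3 : (W.u m : ℝ) ≤ W.l + W.r + W.exc.card := by exact_mod_cast h2
  linarith

theorem Extremal.exists_top (h : W.Extremal) : ∃ m, m ∈ W.reg (W.l + W.r) W.p := by
  have e := h.exc_card
  have hn := W.le_card_reg (lo := W.l + W.r) le_rfl
  exact Finset.card_pos.mp (by omega)

/-- The upper rows cannot all lie in the window. -/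
theorem Extremal.upper_window (h : W.Extremal)
    (hw : ∀ m ∈ W.reg (max W.l W.r) (W.l + W.r), ∃ j : ℤ,
      0 ≤ W.s + W.l + W.r - W.u m + W.p * j ∧
      W.s + W.l + W.r - W.u m + W.p * j < W.l + W.r) : False := by
  have e := h.exc_card
  have le := h.le
  have h1 := W.card_window (W.reg (max W.l W.r) W.p) fun m hm => by
    have hm' := W.mem_reg.mp hm
    refine ⟨hm'.1.1, ?_⟩
    by_cases hu : W.l + W.r ≤ W.u m
    · exact window_of_top (W.mem_reg.mpr ⟨⟨hm'.1.1, hu, hm'.1.2.2⟩, hm'.2⟩)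
    · exact hw m (W.mem_reg.mpr ⟨⟨hm'.1.1, hm'.1.2.1, by omega⟩, hm'.2⟩)
  have h2 := W.le_card_reg (lo := max W.l W.r) le_rfl
  omega

/-- The top and bottom rows cannot all lie in the window. -/
theorem Extremal.outer_window (h : W.Extremal)
    (hw : ∀ m ∈ W.reg 0 (min W.l W.r), ∃ j : ℤ,
      0 ≤ W.s + W.l + W.r - W.u m + W.p * j ∧
      W.s + W.l + W.r - W.u m + W.p * j < W.l + W.r) : False := by
  have e := h.exc_card
  have le := h.le
  set A := (Finset.range W.p).filter fun m => 0 ≤ W.u m ∧ W.u m < min W.l W.r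
  set B := (Finset.range W.p).filter fun m => W.l + W.r ≤ W.u m ∧ W.u m < W.p
  have h1 := W.card_window ((A ∪ B) \ W.exc) fun m hm => by
    simp only [A, B, Finset.mem_sdiff, Finset.mem_union, Finset.mem_filter,
      Finset.mem_range] at hm
    refine ⟨by omega, ?_⟩
    rcases hm.1 with hu | hu
    · exact hw m (W.mem_reg.mpr ⟨hu, hm.2⟩)
    · exact window_of_top (W.mem_reg.mpr ⟨hu, hm.2⟩)
  have h2 := Finset.le_card_sdiff W.exc (A ∪ B)
  have h3 : A.card = min W.l W.r - 0 := W.card_rows (by omega)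
  have h4 : B.card = W.p - (W.l + W.r) := W.card_rows le_rfl
  rw [Finset.card_union_of_disjoint] at h2
  · omega
  · rw [Finset.disjoint_left]
    intro m hm hm'
    simp only [A, B, Finset.mem_filter, Finset.mem_range] at hm hm'
    omega

section StepOne

theorem row_eq (hc : W.c = 1) {m : ℕ} (hm : m < W.p) :
    (m ≤ W.u 0 ∧ W.u m + m = W.u 0) ∨ (W.u 0 < m ∧ W.u m + m = W.u 0 + W.p) := by
  have h0 := W.u_lt 0 W.p_pos
  rcases le_or_gt m (W.u 0) with h | h
  · have := u_eq_of_congr (W := W) (m := 0) (k := m) (by omega) (t := m) (z := 0)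
      (by rw [hc]; push_cast; ring) (by omega) (by omega)
    rw [zero_add] at this
    omega
  · have := u_eq_of_congr (W := W) (m := 0) (k := m) (by omega) (t := m - W.p) (z := 1)
      (by rw [hc]; push_cast; ring) (by omega) (by omega)
    rw [zero_add] at this
    omega

theorem Extremal.false_of_nonneg (h : W.Extremal) (hc : W.c = 1) (ha : 0 ≤ W.a)
    (ha1 : W.a ≤ 1) : False := by
  have e := h.exc_card
  have le := h.le
  have hs := h.s_lt
  have hp : (0 : ℝ) < W.p := by exact_mod_cast W.p_pos
  have step : ∀ m k, m + k < W.p → (∃ z : ℤ, W.x (m + k) = W.x m + k * W.a + W.p * z) ∧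
      ∃ z : ℤ, W.y (m + k) = W.y m + k * (1 - W.a) + W.p * z := fun m k hm => by
    refine ⟨W.x_step m k hm, ?_⟩
    have := W.y_step m k hm
    rwa [hc, Nat.cast_one] at this
  -- Rows fall by one per step and wrap once. If all middle rows follow a single top point m on the
  -- same descent, both coordinates advance from m without passing p, so the sums are the expected
  -- ones and the middle rows enter the window.
  by_cases hA : ∃ m ∈ W.reg (W.l + W.r) W.p, ∀ m' < W.p, max W.l W.r ≤ W.u m' →
      W.u m' < W.l + W.r → m ≤ m' ∧ W.u m' + m' = W.u m + m
  · obtain ⟨m, hm, hA⟩ := hA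
    apply h.upper_window
    intro m' hm'
    obtain ⟨⟨hm'p, hu, hu'⟩, hex⟩ := W.mem_reg.mp hm'
    obtain ⟨hle, heq⟩ := hA m' hm'p hu hu'
    obtain ⟨⟨hmp, hmu, -⟩, hmex⟩ := W.mem_reg.mp hm
    obtain ⟨t1, t2, t3⟩ := W.top hmp hmex hmu
    have x0 := W.x_nonneg m hmp
    have y0 := W.y_nonneg m hmp
    obtain ⟨k, rfl⟩ := Nat.exists_eq_add_of_le hle
    obtain ⟨⟨z1, hz1⟩, z2, hz2⟩ := step m k hm'p
    have hk : (W.u m : ℝ) = W.u (m + k) + k := by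
      have : W.u m = W.u (m + k) + k := by omega
      exact_mod_cast this
    have k1 : 0 ≤ (k : ℝ) * W.a := by positivity
    have k2 : 0 ≤ (k : ℝ) * (1 - W.a) := mul_nonneg (by positivity) (by linarith)
    have hbd : (2 * (W.l + W.r) + W.exc.card : ℝ) ≤ W.p + W.u (m + k) := by
      have : 2 * (W.l + W.r) + W.exc.card ≤ W.p + W.u (m + k) := by omega
      exact_mod_cast this
    have hx := eq_of_congr (W.x_nonneg _ hm'p) (W.x_lt _ hm'p) (by linarith) (by linarith) hz1
    have hy := eq_of_congr (W.y_nonneg _ hm'p) (W.y_lt _ hm'p) (by linarith) (by linarith) hz2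
    have hsum : W.x (m + k) + W.y (m + k) + W.u (m + k) = W.s + W.l + W.r := by
      rw [hx, hy]; linarith
    obtain ⟨f1, f2⟩ := W.upper hm'p hex hu hsum
    have := W.x_nonneg _ hm'p
    have := W.y_nonneg _ hm'p
    refine ⟨0, ?_⟩
    push_cast
    constructor <;> linarith
  -- Otherwise all unexceptional top points come after the wrap and the walk starts at row max(l, r)
  -- or above. The bottom rows then precede such a point; running back to them places their expected
  -- sums, lowered by p, in the window.
  · push Not at hA
    have hu0 : ∀ m ∈ W.reg (W.l + W.r) W.p, W.u 0 < m := by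
      intro m hm
      obtain ⟨m', hm'p, h1, h2, h3⟩ := hA m hm
      obtain ⟨⟨hmp, hmu, -⟩, -⟩ := W.mem_reg.mp hm
      have r1 := row_eq hc hmp
      have r2 := row_eq hc hm'p
      by_contra hne
      have := h3 (by omega)
      omega
    obtain ⟨m, hm⟩ := h.exists_top
    obtain ⟨⟨hmp, hmu, -⟩, hmex⟩ := W.mem_reg.mp hm
    have r1 := row_eq hc hmp
    have h1 := hu0 m hm
    have hbe : max W.l W.r ≤ W.u 0 := by
      obtain ⟨m', hm'p, g1, g2, g3⟩ := hA m hm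
      have r2 := row_eq hc hm'p
      by_contra hne
      have := g3 (by omega)
      omega
    obtain ⟨t1, t2, t3⟩ := W.top hmp hmex hmu
    apply h.outer_window
    intro m' hm'
    obtain ⟨⟨hm'p, -, hu'⟩, hex⟩ := W.mem_reg.mp hm'
    have r2 := row_eq hc hm'p
    obtain ⟨k, rfl⟩ := Nat.exists_eq_add_of_le (show m' ≤ m by omega)
    obtain ⟨⟨z1, hz1⟩, z2, hz2⟩ := step m' k hmp
    have hk : (W.u (m' + k) : ℝ) + k = W.u m' + W.p := by
      have : W.u (m' + k) + k = W.u m' + W.p := by omega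
      exact_mod_cast this
    have hkp : (k : ℝ) < W.p := by
      have : k < W.p := by omega
      exact_mod_cast this
    have k1 : 0 ≤ (k : ℝ) * W.a := by positivity
    have k2 : 0 ≤ (k : ℝ) * (1 - W.a) := mul_nonneg (by positivity) (by linarith)
    have hl : 2 * (W.l : ℝ) < W.p := by exact_mod_cast W.two_l
    have hr : 2 * (W.r : ℝ) < W.p := by exact_mod_cast W.two_r
    have x0 := W.x_nonneg _ hmp
    have y0 := W.y_nonneg _ hmp
    have x1 := W.x_nonneg _ hm'p
    have y1 := W.y_nonneg _ hm'p
    have hx : W.x m' = W.x (m' + k) - k * W.a ∨ W.x m' = W.x (m' + k) - k * W.a + W.p := by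
      rcases le_or_gt 0 (W.x (m' + k) - k * W.a) with g | g
      · left
        exact eq_of_congr x1 (W.x_lt _ hm'p) g (by linarith) (z := -z1)
          (by rw [hz1]; push_cast; ring)
      · right
        exact eq_of_congr x1 (W.x_lt _ hm'p) (by linarith) (by linarith) (z := -z1 - 1)
          (by rw [hz1]; push_cast; ring)
    have hy : W.y m' = W.y (m' + k) - k * (1 - W.a) ∨
        W.y m' = W.y (m' + k) - k * (1 - W.a) + W.p := by
      rcases le_or_gt 0 (W.y (m' + k) - k * (1 - W.a)) with g | g
      · left
        exact eq_of_congr y1 (W.y_lt _ hm'p) g (by linarith) (z := -z2)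
          (by rw [hz2]; push_cast; ring)
      · right
        exact eq_of_congr y1 (W.y_lt _ hm'p) (by linarith) (by linarith) (z := -z2 - 1)
          (by rw [hz2]; push_cast; ring)
    refine ⟨-1, ?_⟩
    push_cast
    rcases W.bottom hm'p hex hu' with ⟨b1, -⟩ | ⟨b1, b2, b3⟩ <;> rcases hx with hx | hx <;>
      rcases hy with hy | hy <;> first
        | (exfalso; linarith)
        | (constructor <;> linarith)

theorem same_segment (hc : W.c = 1) {m m' n : ℕ} (hm : m < W.p) (hm' : m' < W.p)
    (h : W.u m + m = W.u m' + m') (h1 : m ≤ n) (h2 : n ≤ m') : W.u n + n = W.u m + m := by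
  have r1 := row_eq hc hm
  have r2 := row_eq hc hm'
  have r3 := row_eq hc (show n < W.p by omega)
  omega

/-- Induction on k: a box for k + 1 steps determines the displacements modulo p, and the bounds for
k steps are good enough, since 3l, 3r < p, to exclude a nonzero multiple of p. -/
theorem Extremal.step_lt (h : W.Extremal) (hp : 11 ≤ W.p) (hc : W.c = 1) (ha : |W.a| < W.l)
    (hb : |1 - W.a| < W.r) (ha0 : W.a < 0) {k : ℕ} (hk : k ≤ W.exc.card + 1) :
    k * |W.a| < W.l ∧ k * (1 - W.a) < W.r := by
  have e := h.exc_card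
  have le := h.le
  have hl3 : 3 * (W.l : ℝ) < W.p := by exact_mod_cast (by omega : 3 * W.l < W.p)
  have hr3 : 3 * (W.r : ℝ) < W.p := by exact_mod_cast (by omega : 3 * W.r < W.p)
  rw [abs_of_neg ha0] at ha ⊢
  rw [abs_of_pos (by linarith)] at hb
  induction k with
  | zero => simp; omega
  | succ k ih =>
    obtain ⟨ih1, ih2⟩ := ih (by omega)
    have v : visitBound W.p W.c (k + 1) (W.p - (W.l + W.r + (k + 1))) ≤ k + 1 := min_le_left _ _
    obtain ⟨A, B, hA, hB, -, ⟨z1, hz1⟩, z2, hz2⟩ := exists_box (W := W) (k := k + 1) (by omega)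
      (t := k + 1) (z := 0) (by rw [hc]; push_cast; ring) (lo := W.l + W.r + (k + 1)) (hi := W.p)
      (by omega) (by push_cast; omega) le_rfl (by omega) (by omega)
    rw [abs_lt] at hA hB
    have k0 : (0 : ℝ) ≤ k := by positivity
    have g1 : 0 ≤ (k : ℝ) * -W.a := mul_nonneg k0 (by linarith)
    have g2 : 0 ≤ (k : ℝ) * (1 - W.a) := mul_nonneg k0 (by linarith)
    rw [hc] at hz2
    push_cast at hz1 hz2 ⊢
    have f1 := eq_of_congr (p := W.p) (a := (k + 1) * W.a + 2 * W.l) (b := A + 2 * W.l) (z := z1)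
      (by linarith) (by linarith) (by linarith) (by linarith) (by linarith)
    have f2 := eq_of_congr (p := W.p) (a := (k + 1) * (1 - W.a) + W.r) (b := B + W.r) (z := z2)
      (by linarith) (by linarith) (by linarith) (by linarith) (by linarith)
    constructor <;> linarith

/-- A gap longer than e + 1 contains an unexceptional index in its first e + 1 steps, so long gaps
split into short ones, on which `Extremal.step_lt` rules out wrapping. -/
theorem Extremal.y_linear (h : W.Extremal) (hp : 11 ≤ W.p) (hc : W.c = 1) (ha : |W.a| < W.l)
    (hb : |1 - W.a| < W.r) (ha0 : W.a < 0) (d : ℕ) : ∀ m, m ∈ W.reg (W.l + W.r) W.p →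
      m + d ∈ W.reg (W.l + W.r) W.p → W.u m = W.u (m + d) + d →
      W.y (m + d) = W.y m + d * (1 - W.a) := by
  have hr : 2 * (W.r : ℝ) < W.p := by exact_mod_cast W.two_r
  induction d using Nat.strong_induction_on with
  | _ d ih =>
    intro m hm hmd hu
    obtain ⟨⟨hmp, hmu, -⟩, hmex⟩ := W.mem_reg.mp hm
    obtain ⟨⟨hdp, hdu, -⟩, hdex⟩ := W.mem_reg.mp hmd
    by_cases hd : d ≤ W.exc.card + 1
    · obtain ⟨t1, t2, t3⟩ := W.top hmp hmex hmu
      have g1 := (h.step_lt hp hc ha hb ha0 hd).2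
      have g2 : 0 ≤ (d : ℝ) * (1 - W.a) := mul_nonneg (by positivity) (by linarith)
      obtain ⟨z, hz⟩ := W.y_step m d hdp
      rw [hc, Nat.cast_one] at hz
      have y0 := W.y_nonneg m hmp
      exact eq_of_congr (W.y_nonneg _ hdp) (W.y_lt _ hdp) (by linarith) (by linarith) hz
    · have hcard : W.exc.card < (Finset.Ioc m (m + W.exc.card + 1)).card := by
        rw [Nat.card_Ioc]; omega
      obtain ⟨n, hn, hnex⟩ := Finset.exists_mem_notMem_of_card_lt_card hcard
      rw [Finset.mem_Ioc] at hn
      have hseg := same_segment hc hmp hdp (by omega) (n := n) (by omega) (by omega)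
      obtain ⟨i, rfl⟩ := Nat.exists_eq_add_of_le (show m ≤ n by omega)
      obtain ⟨j, rfl⟩ := Nat.exists_eq_add_of_le (show i ≤ d by omega)
      have hlt := W.u_lt (m + i) (by omega)
      have hi : m + i ∈ W.reg (W.l + W.r) W.p :=
        W.mem_reg.mpr ⟨⟨by omega, by omega, hlt⟩, hnex⟩
      have e1 := ih i (by omega) m hm hi (by omega)
      have e2 := ih j (by omega) (m + i) hi (by rwa [add_assoc]) (by rw [add_assoc]; omega)
      rw [← add_assoc, e2, e1]
      push_cast; ring

/-- The second coordinate grows linearly from the first to the last index of S, yet stays in [0, r).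
-/
theorem Extremal.segment_card (h : W.Extremal) (hp : 11 ≤ W.p) (hc : W.c = 1) (ha : |W.a| < W.l)
    (hb : |1 - W.a| < W.r) (ha0 : W.a < 0) {S : Finset ℕ} {K : ℕ}
    (hS : S ⊆ W.reg (W.l + W.r) W.p) (hK : ∀ m ∈ S, W.u m + m = K) :
    ((S.card : ℝ) - 1) * (1 - W.a) < W.r := by
  rcases S.eq_empty_or_nonempty with rfl | hne
  · have := (abs_nonneg _).trans_lt hb
    simp; linarith
  have i1 := S.min'_mem hne
  have i2 := S.max'_mem hne
  have hsub : S ⊆ Finset.Icc (S.min' hne) (S.max' hne) := fun m hm =>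
    Finset.mem_Icc.mpr ⟨S.min'_le m hm, S.le_max' m hm⟩
  have hcard := Finset.card_le_card hsub
  rw [Nat.card_Icc] at hcard
  have hle := S.min'_le _ i2
  generalize S.min' hne = m at *
  generalize S.max' hne = n at *
  obtain ⟨d, rfl⟩ := Nat.exists_eq_add_of_le hle
  have k1 := hK _ i1
  have k2 := hK _ i2
  have e := h.y_linear hp hc ha hb ha0 d m (hS i1) (hS i2) (by omega)
  obtain ⟨⟨hmp, hmu, -⟩, hmex⟩ := W.mem_reg.mp (hS i1)
  obtain ⟨⟨hdp, hdu, -⟩, hdex⟩ := W.mem_reg.mp (hS i2)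
  have := (W.top hdp hdex hdu).2.1
  have := W.y_nonneg m hmp
  have hc' : (S.card : ℝ) ≤ d + 1 := by
    have : S.card ≤ d + 1 := by omega
    exact_mod_cast this
  have : ((S.card : ℝ) - 1) * (1 - W.a) ≤ d * (1 - W.a) :=
    mul_le_mul_of_nonneg_right (by linarith) (by linarith)
  linarith

/-- The numerical contradiction for a walk whose second coordinate winds at least twice. -/
theorem winding_numbers {p al be e n D : ℕ} (hp : 11 ≤ p) (hp' : p.Prime) (hab : al ≤ be)
    (hne : ¬ (p = 13 ∧ al = 4 ∧ be = 4))
    (h1 : 3 * e + 3 * be + 1 ≤ p) (h2 : 2 * p + 1 ≤ 6 * al + 3 * be)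
    (hn : p ≤ n + e + al + be) (hD : D ≤ al + be + e + 1) :
    2 * be * D ≤ (n - 2) * (2 * p - be) := by
  -- The comparison `b3` amounts to p² - 17p - 2 ≥ 0, whence the threshold; below it only 11, 13 and
  -- 17 remain.
  by_cases h18 : 18 ≤ p
  · have g1 : 3 * D ≤ 2 * p + 1 := by omega
    have g2 : p ≤ 3 * (n - 2) + 4 := by omega
    have g3 : 3 * be ≤ p - 1 := by omega
    have g4 : 5 * p + 1 ≤ 3 * (2 * p - be) := by omega
    have b1 : (3 * be) * (3 * D) ≤ (p - 1) * (2 * p + 1) := Nat.mul_le_mul g3 g1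
    have b2 : (p - 4) * (5 * p + 1) ≤ (3 * (n - 2)) * (3 * (2 * p - be)) :=
      Nat.mul_le_mul (by omega) g4
    have b3 : 2 * ((p - 1) * (2 * p + 1)) ≤ (p - 4) * (5 * p + 1) := by
      obtain ⟨t, rfl⟩ : ∃ t, p = t + 18 := ⟨p - 18, by omega⟩
      rw [show t + 18 - 1 = t + 17 by omega, show t + 18 - 4 = t + 14 by omega]
      nlinarith
    nlinarith
  · have b0 : 2 * be * D ≤ 2 * be * (al + be + e + 1) := Nat.mul_le_mul_left _ hD
    have b1 : (p - e - al - be - 2) * (2 * p - be) ≤ (n - 2) * (2 * p - be) :=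
      Nat.mul_le_mul_right _ (by omega)
    refine b0.trans (le_trans ?_ b1)
    clear b0 b1 hn hD
    have hbe : be ≤ 5 := by omega
    interval_cases p <;> first | (exfalso; revert hp'; norm_num; done) | skip
    all_goals
      clear hp hp' h18
      interval_cases be <;> omega

set_option maxHeartbeats 1000000 in
theorem Extremal.false_of_neg (h : W.Extremal) (hp : 11 ≤ W.p) (hc : W.c = 1) (ha : |W.a| < W.l)
    (hb : |1 - W.a| < W.r) (ha0 : W.a < 0) : False := by
  have e := h.exc_card
  have le := h.le
  have hp0 : (0 : ℝ) < W.p := by exact_mod_cast W.p_pos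
  have hr0 : (0 : ℝ) < W.r := (abs_nonneg _).trans_lt hb
  have hr3 : 3 * (W.r : ℝ) < W.p := by exact_mod_cast (by omega : 3 * W.r < W.p)
  have hl3 : 3 * (W.l : ℝ) < W.p := by exact_mod_cast (by omega : 3 * W.l < W.p)
  have hn := W.le_card_reg (lo := W.l + W.r) le_rfl
  set S := (W.reg (W.l + W.r) W.p).filter fun m => m ≤ W.u 0 with hSdef
  set T := (W.reg (W.l + W.r) W.p).filter fun m => ¬ m ≤ W.u 0 with hTdef
  have hST : S.card + T.card = (W.reg (W.l + W.r) W.p).card :=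
    Finset.card_filter_add_card_filter_not _
  have hSmem : ∀ m ∈ S, m ∈ W.reg (W.l + W.r) W.p ∧ m ≤ W.u 0 ∧ W.u m + m = W.u 0 := by
    intro m hm
    obtain ⟨h1, h2⟩ := Finset.mem_filter.mp hm
    have := row_eq hc (W.mem_reg.mp h1).1.1
    exact ⟨h1, h2, by omega⟩
  have hTmem : ∀ m ∈ T, m ∈ W.reg (W.l + W.r) W.p ∧ W.u 0 < m ∧ W.u m + m = W.u 0 + W.p := by
    intro m hm
    obtain ⟨h1, h2⟩ := Finset.mem_filter.mp hm
    have := row_eq hc (W.mem_reg.mp h1).1.1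
    exact ⟨h1, by omega, by omega⟩
  have cS := h.segment_card hp hc ha hb ha0 (Finset.filter_subset _ _) fun m hm => (hSmem m hm).2.2
  have cT := h.segment_card hp hc ha hb ha0 (Finset.filter_subset _ _) fun m hm => (hTmem m hm).2.2
  rw [← hSdef] at cS
  rw [← hTdef] at cT
  have single : ∀ n : ℕ, W.r < n → ((n : ℝ) - 1) * (1 - W.a) < W.r → False := by
    intro n hn hlt
    have : (W.r : ℝ) + 1 ≤ n := by exact_mod_cast hn
    nlinarith
  rcases S.eq_empty_or_nonempty with hSe | hSne
  · rw [hSe, Finset.card_empty] at hST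
    exact single _ (by omega) cT
  rcases T.eq_empty_or_nonempty with hTe | hTne
  · rw [hTe, Finset.card_empty] at hST
    exact single _ (by omega) cS
  have i1 := S.max'_mem hSne
  have i2 := T.min'_mem hTne
  have o1 : ∀ x ∈ S, x ≤ S.max' hSne := fun x hx => S.le_max' x hx
  have o2 : ∀ x ∈ T, T.min' hTne ≤ x := fun x hx => T.min'_le x hx
  generalize S.max' hSne = m at *
  generalize T.min' hTne = n at *
  obtain ⟨hmr, hm0, hmu⟩ := hSmem m i1
  obtain ⟨hnr, hn0, hnu⟩ := hTmem n i2
  obtain ⟨⟨hmp, hml, -⟩, hmex⟩ := W.mem_reg.mp hmr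
  obtain ⟨⟨hnp, hnl, -⟩, hnex⟩ := W.mem_reg.mp hnr
  obtain ⟨s1, s2, s3⟩ := W.top hmp hmex hml
  obtain ⟨t1, t2, t3⟩ := W.top hnp hnex hnl
  have x0 := W.x_nonneg m hmp
  have y0 := W.y_nonneg m hmp
  have x1 := W.x_nonneg n hnp
  have y1 := W.y_nonneg n hnp
  obtain ⟨d, rfl⟩ := Nat.exists_eq_add_of_le (show m ≤ n by omega)
  obtain ⟨z1, hz1⟩ := W.x_step m d hnp
  obtain ⟨z2, hz2⟩ := W.y_step m d hnp
  rw [hc, Nat.cast_one] at hz2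
  have hdpos : (0 : ℝ) < d := by
    have : 0 < d := by omega
    exact_mod_cast this
  have hda : (d : ℝ) * W.a < 0 := mul_neg_of_pos_of_neg hdpos ha0
  have hdb : 0 < (d : ℝ) * (1 - W.a) := mul_pos hdpos (by linarith)
  have hud : (W.u (m + d) : ℝ) + d = W.u m + W.p := by
    have : W.u (m + d) + d = W.u m + W.p := by omega
    exact_mod_cast this
  have hzz : z1 + z2 = -1 := by
    have : (W.p : ℝ) * (z1 + z2) = W.p * (-1) := by linarith
    exact_mod_cast mul_left_cancel₀ hp0.ne' this
  have hz2neg : z2 ≤ -1 := by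
    by_contra hne
    have : z1 ≤ -1 := by omega
    have : (z1 : ℝ) ≤ -1 := by exact_mod_cast this
    nlinarith
  -- Between the last top point before the wrap and the first one after it, y winds -z2 times. If it
  -- winds once, x does not wrap, and every unexceptional middle row falls into the window with j =
  -- 0 or j = -1.
  rcases eq_or_lt_of_le hz2neg with hz | hz
  · subst hz
    obtain rfl : z1 = 0 := by omega
    push_cast at hz1 hz2
    apply h.upper_window
    intro i hi
    obtain ⟨⟨hip, hiu, hiu'⟩, hiex⟩ := W.mem_reg.mp hi
    have hri := row_eq hc hip
    obtain ⟨k, rfl⟩ := Nat.exists_eq_add_of_le (show m ≤ i by omega)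
    obtain ⟨f, rfl⟩ := Nat.exists_eq_add_of_le (show k ≤ d by omega)
    have hka : (k : ℝ) * W.a ≤ 0 := mul_nonpos_of_nonneg_of_nonpos (by positivity) ha0.le
    have hkb : 0 ≤ (k : ℝ) * (1 - W.a) := mul_nonneg (by positivity) (by linarith)
    have hfa : (f : ℝ) * W.a ≤ 0 := mul_nonpos_of_nonneg_of_nonpos (by positivity) ha0.le
    have hfb : 0 ≤ (f : ℝ) * (1 - W.a) := mul_nonneg (by positivity) (by linarith)
    push_cast at hz1 hz2
    obtain ⟨w1, hw1⟩ := W.x_step m k hip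
    obtain ⟨w2, hw2⟩ := W.y_step m k hip
    rw [hc, Nat.cast_one] at hw2
    have hx := eq_of_congr (W.x_nonneg _ hip) (W.x_lt _ hip) (by linarith) (by linarith) hw1
    have hui : (W.u (m + k) : ℝ) + k = W.u m := by
      have : W.u (m + k) + k = W.u m := by omega
      exact_mod_cast this
    have hx0 := W.x_nonneg _ hip
    have hy0 := W.y_nonneg _ hip
    rcases lt_or_ge (W.y m + k * (1 - W.a)) W.p with g | g
    · have hy := eq_of_congr (W.y_nonneg _ hip) (W.y_lt _ hip) (by linarith) g hw2
      have := W.upper hip hiex hiu (by rw [hx, hy]; linarith)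
      refine ⟨0, ?_⟩
      push_cast
      constructor <;> linarith
    · have hy := eq_of_congr (b := W.y m + k * (1 - W.a) - W.p) (z := w2 + 1) (W.y_nonneg _ hip)
        (W.y_lt _ hip) (by linarith) (by linarith) (by rw [hw2]; push_cast; ring)
      refine ⟨-1, ?_⟩
      push_cast
      constructor <;> linarith
  · have hz' : (z2 : ℝ) ≤ -2 := by exact_mod_cast (by omega : z2 ≤ -2)
    -- With two or more windings the speed 1 - a must be large relative to d, whereas the two
    -- segments, via `cS` and `cT`, keep it small.
    have hwind : 2 * (W.p : ℝ) - W.r < d * (1 - W.a) := by nlinarith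
    have hD : d ≤ min W.l W.r + max W.l W.r + W.exc.card + 1 := by
      have hsub : Finset.Ioo m (m + d) ⊆ W.exc ∪
          (Finset.range W.p).filter fun i => 0 ≤ W.u i ∧ W.u i < W.l + W.r := by
        intro i hi
        rw [Finset.mem_Ioo] at hi
        rw [Finset.mem_union, Finset.mem_filter, Finset.mem_range]
        by_contra hne
        push Not at hne
        have hir : i ∈ W.reg (W.l + W.r) W.p :=
          W.mem_reg.mpr ⟨⟨by omega, hne.2 (by omega) (by omega), W.u_lt i (by omega)⟩, hne.1⟩
        rcases le_or_gt i (W.u 0) with g | g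
        · have := o1 i (Finset.mem_filter.mpr ⟨hir, g⟩); omega
        · have := o2 i (Finset.mem_filter.mpr ⟨hir, by omega⟩); omega
      have q1 := Finset.card_le_card hsub
      have q2 := Finset.card_union_le W.exc
        ((Finset.range W.p).filter fun i => 0 ≤ W.u i ∧ W.u i < W.l + W.r)
      rw [W.card_rows (by omega)] at q2
      rw [Nat.card_Ioo] at q1
      rw [min_add_max]
      omega
    -- The configuration excluded from `winding_numbers` does not occur: 4 · 4 ≡ 3 modulo 13 gives c
    -- = 3.
    have hne : ¬ (W.p = 13 ∧ min W.l W.r = 4 ∧ max W.l W.r = 4) := by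
      rintro ⟨q1, q2, q3⟩
      have := W.c_eq
      rw [q1, q2, q3, hc] at this
      norm_num at this
    have hnum := winding_numbers (al := min W.l W.r) (be := max W.l W.r) (e := W.exc.card)
      (n := S.card + T.card) hp W.prime min_le_max hne e le (by omega) hD
    have hn2 : 2 < S.card + T.card := by omega
    have hr : W.r ≤ max W.l W.r := le_max_right _ _
    have hnum' : (2 * W.r * d : ℝ) ≤ (S.card + T.card - 2) * (2 * W.p - W.r) := by
      have : 2 * W.r * d ≤ (S.card + T.card - 2) * (2 * W.p - W.r) :=
        le_trans (by gcongr) (hnum.trans (by gcongr))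
      have h2p : W.r ≤ 2 * W.p := by omega
      have : ((2 * W.r * d : ℕ) : ℝ) ≤ ((S.card + T.card - 2) * (2 * W.p - W.r) : ℕ) := by
        exact_mod_cast this
      push_cast [Nat.cast_sub hn2.le, Nat.cast_sub h2p] at this
      exact this
    have hN : (0 : ℝ) < S.card + T.card - 2 := by
      have : (2 : ℝ) < S.card + T.card := by exact_mod_cast hn2
      linarith
    have c1 : ((S.card + T.card - 2 : ℝ)) * (1 - W.a) < 2 * W.r := by linarith
    have c2 : ((S.card + T.card - 2 : ℝ)) * (2 * W.p - W.r) <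
        (S.card + T.card - 2) * (d * (1 - W.a)) := mul_lt_mul_of_pos_left hwind hN
    have c3 := mul_lt_mul_of_pos_left c1 hdpos
    linarith

/-- A one-step box replaces a by a representative A with |A| < l and |1 - A| < r. Either both
coordinates move forward, or one moves backward; `swap` lets this be the first. -/
theorem Extremal.c_ne_one (h : W.Extremal) (hp : 11 ≤ W.p) : W.c ≠ 1 := by
  intro hc
  have e := h.exc_card
  have le := h.le
  have v : visitBound W.p W.c 1 (W.p - (W.l + W.r + 1)) ≤ 1 := min_le_left _ _
  obtain ⟨A, B, hA, hB, hAB, ⟨z1, hz1⟩, z2, hz2⟩ := exists_box (W := W) (k := 1) (by omega)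
    (t := 1) (z := 0) (by rw [hc]; push_cast; ring) (lo := W.l + W.r + 1) (hi := W.p)
    (by omega) (by push_cast; omega) le_rfl (by omega) (by omega)
  push_cast at hAB hz1
  obtain rfl : B = 1 - A := by linarith
  have h' : (W.withStep A z1 (by linarith)).Extremal := h
  rcases lt_or_ge A 0 with hA0 | hA0
  · exact h'.false_of_neg hp hc hA hB hA0
  rcases lt_or_ge 1 A with hA1 | hA1
  · have hc1 : (W.c : ℝ) = 1 := by rw [hc, Nat.cast_one]
    refine h'.swap.false_of_neg hp hc (show |(W.c : ℝ) - A| < W.r by rwa [hc1])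
      (show |1 - ((W.c : ℝ) - A)| < W.l by rwa [hc1, sub_sub_cancel])
      (show (W.c : ℝ) - A < 0 by rw [hc1]; linarith)
  · exact h'.false_of_nonneg hc hA0 hA1

end StepOne

end CircleWalk

/-! ### The case of c close to p/3. -/

namespace CircleWalk

variable {W : CircleWalk}

/-- This is the congruence c ≡ ±lr multiplied by 9, written in the deviations of 3c, 3l, 3r from p.
-/
theorem third_relation {ε α β : ℤ} (hε : 3 * (W.c : ℤ) = W.p + ε)
    (hα : 3 * (min W.l W.r : ℕ) = (W.p : ℤ) - α) (hβ : 3 * (max W.l W.r : ℕ) = (W.p : ℤ) - β) :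
    (W.p : ℤ) ∣ 3 * ε - α * β ∨ (W.p : ℤ) ∣ 3 * ε + α * β := by
  have hlr : (W.l * W.r : ℤ) = (min W.l W.r : ℕ) * (max W.l W.r : ℕ) := by
    exact_mod_cast (min_mul_max W.l W.r).symm
  have h9 : 9 * (W.l * W.r : ℤ) = (W.p - α) * (W.p - β) := by
    rw [hlr, ← hα, ← hβ]; ring
  rcases W.rel with ⟨z, hz⟩ | ⟨z, hz⟩
  · exact Or.inl ⟨9 * z - 3 + W.p - α - β, by linear_combination 9 * hz - 3 * hε + h9⟩
  · exact Or.inr ⟨9 * z - 3 - W.p + α + β, by linear_combination 9 * hz - 3 * hε - h9⟩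

theorem third_relation_small {ε α β : ℤ} (hε : 3 * (W.c : ℤ) = W.p + ε)
    (hα : 3 * (min W.l W.r : ℕ) = (W.p : ℤ) - α) (hβ : 3 * (max W.l W.r : ℕ) = (W.p : ℤ) - β)
    (h1 : |3 * ε - α * β| < W.p) (h2 : |3 * ε + α * β| < W.p) :
    3 * ε - α * β = 0 ∨ 3 * ε + α * β = 0 := by
  rcases third_relation hε hα hβ with h | h
  · exact Or.inl (Int.eq_zero_of_abs_lt_dvd h h1)
  · exact Or.inr (Int.eq_zero_of_abs_lt_dvd h h2)

theorem p_mod_three (hp : 11 ≤ W.p) : W.p % 3 ≠ 0 := fun h0 => by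
  have := (Nat.prime_dvd_prime_iff_eq Nat.prime_three W.prime).mp (Nat.dvd_of_mod_eq_zero h0)
  omega

/-- The bound on l + r leaves six triples of deviations. All are so small that the congruence of
`third_relation` becomes an equality, and it fails for each of them. -/
theorem Extremal.false_of_near_third (h : W.Extremal) (hp : 11 ≤ W.p) (hc : 3 * W.c ≤ W.p + 2)
    (hc' : W.p ≤ 3 * W.c + 2) (hlr : 2 * W.p ≤ 3 * (W.l + W.r) + 5) : False := by
  have e := h.exc_card
  have h3 := p_mod_three hp
  have hmm : min W.l W.r + max W.l W.r = W.l + W.r := min_add_max _ _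
  have hle : min W.l W.r ≤ max W.l W.r := min_le_max
  have hcases : (3 * max W.l W.r + 1 = W.p ∧ (3 * min W.l W.r + 1 = W.p ∨ 3 * min W.l W.r + 4 = W.p) ∧
      (3 * W.c + 1 = W.p ∨ 3 * W.c = W.p + 2)) ∨
      (3 * max W.l W.r + 2 = W.p ∧ 3 * min W.l W.r + 2 = W.p ∧
        (3 * W.c + 2 = W.p ∨ 3 * W.c = W.p + 1)) := by omega
  have small : ∀ n : ℤ, -10 ≤ n → n ≤ 10 → |n| < W.p := fun n h1 h2 => by
    rw [abs_lt]; omega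
  rcases hcases with ⟨hb, ha | ha, hc | hc⟩ | ⟨hb, ha, hc | hc⟩
  · have := third_relation_small (W := W) (ε := -1) (α := 1) (β := 1) (by omega) (by omega)
      (by omega) (small _ (by norm_num) (by norm_num)) (small _ (by norm_num) (by norm_num))
    norm_num at this
  · have := third_relation_small (W := W) (ε := 2) (α := 1) (β := 1) (by omega) (by omega)
      (by omega) (small _ (by norm_num) (by norm_num)) (small _ (by norm_num) (by norm_num))
    norm_num at this
  · have := third_relation_small (W := W) (ε := -1) (α := 4) (β := 1) (by omega) (by omega)
      (by omega) (small _ (by norm_num) (by norm_num)) (small _ (by norm_num) (by norm_num))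
    norm_num at this
  · have := third_relation_small (W := W) (ε := 2) (α := 4) (β := 1) (by omega) (by omega)
      (by omega) (small _ (by norm_num) (by norm_num)) (small _ (by norm_num) (by norm_num))
    norm_num at this
  · have := third_relation_small (W := W) (ε := -2) (α := 2) (β := 2) (by omega) (by omega)
      (by omega) (small _ (by norm_num) (by norm_num)) (small _ (by norm_num) (by norm_num))
    norm_num at this
  · have := third_relation_small (W := W) (ε := 1) (α := 2) (β := 2) (by omega) (by omega)
      (by omega) (small _ (by norm_num) (by norm_num)) (small _ (by norm_num) (by norm_num))
    norm_num at this

/-- Otherwise each block of three consecutive indices contains at most one unexceptional top index,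
and the resulting count makes l + r nearly 2p/3. -/
theorem Extremal.exists_close_pair (h : W.Extremal) (hp : 11 ≤ W.p) (hc : 3 * W.c ≤ W.p + 2)
    (hc' : W.p ≤ 3 * W.c + 2) : ∃ m ∈ W.reg (W.l + W.r) W.p,
      m + 1 ∈ W.reg (W.l + W.r) W.p ∨ m + 2 ∈ W.reg (W.l + W.r) W.p := by
  by_contra hne
  push Not at hne
  have e := h.exc_card
  have hn := W.le_card_reg (lo := W.l + W.r) le_rfl
  have hmm : min W.l W.r + max W.l W.r = W.l + W.r := min_add_max _ _
  have htot : 2 * (W.p : ℤ) < 3 * W.total := h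
  rw [total_eq] at htot
  have hcard : (W.reg (W.l + W.r) W.p).card ≤ ((W.p + 2) / 3) := by
    rw [← Finset.card_range ((W.p + 2) / 3)]
    apply Finset.card_le_card_of_injOn (fun m => m / 3)
    · intro m hm
      have := (W.mem_reg.mp hm).1.1
      simp only [Finset.coe_range, Set.mem_Iio]
      omega
    · intro m hm n hn hmn
      simp only at hmn
      have h1 := hne m hm
      have h2 := hne n hn
      have : m = n ∨ n = m + 1 ∨ n = m + 2 ∨ m = n + 1 ∨ m = n + 2 := by omega
      rcases this with rfl | rfl | rfl | rfl | rfl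
      · rfl
      · exact absurd hn h1.1
      · exact absurd hn h1.2
      · exact absurd hm h2.1
      · exact absurd hm h2.2
  exact h.false_of_near_third hp hc hc' (by omega)

theorem floor_lt_of_top {m : ℕ} (hm : m ∈ W.reg (W.l + W.r) W.p) :
    ⌊W.s⌋₊ < W.u m ∧ W.u m ≤ ⌊W.s⌋₊ + (W.l + W.r) := by
  obtain ⟨h1, h2⟩ := top_bounds hm
  constructor
  · rw [Nat.floor_lt W.s_nonneg]; exact h1
  · have : (W.u m : ℝ) < ⌊W.s⌋₊ + 1 + (W.l + W.r) := by
      have := Nat.lt_floor_add_one W.s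
      linarith
    have : W.u m < ⌊W.s⌋₊ + 1 + (W.l + W.r) := by exact_mod_cast this
    omega

/-- Exceptional rows outside the window together with exceptional pairs. -/
theorem card_exc_ge {k lo hi v w : ℕ} (hk : k ≤ W.p) (hhi : hi ≤ W.p) (hv : ⌊W.s⌋₊ + (W.l + W.r) < v)
    (hw : w ≤ ⌊W.s⌋₊ + 1) (hwp : w ≤ W.p)
    (hpair : ∀ m, m + k < W.p → lo ≤ W.u m → W.u m < hi →
      (m ∈ W.exc ∨ m + k ∈ W.exc) ∧ W.u m < v ∧ (W.u m < W.l + W.r ∨ w ≤ W.u m) ∧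
        W.u (m + k) < v ∧ (W.u (m + k) < W.l + W.r ∨ w ≤ W.u (m + k)) ∧
        ¬ (lo ≤ W.u (m + k) ∧ W.u (m + k) < hi)) :
    (W.p - v) + (w - (W.l + W.r)) + (hi - lo - k) ≤ W.exc.card := by
  classical
  set F := (Finset.range W.p).filter fun m => v ≤ W.u m ∧ W.u m < W.p with hF
  set G := (Finset.range W.p).filter fun m => W.l + W.r ≤ W.u m ∧ W.u m < w with hG
  have cF : F.card = W.p - v := W.card_rows le_rfl
  have cG : G.card = w - (W.l + W.r) := W.card_rows hwp
  have hFG : Disjoint F G := by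
    rw [Finset.disjoint_left]
    intro m hm hm'
    simp only [F, G, Finset.mem_filter] at hm hm'
    omega
  have hsub : F ∪ G ⊆ W.exc := by
    intro m hm
    simp only [F, G, Finset.mem_filter, Finset.mem_union, Finset.mem_range] at hm
    by_contra hne
    have := floor_lt_of_top (W := W) (m := m)
      (W.mem_reg.mpr ⟨⟨by omega, by omega, W.u_lt m (by omega)⟩, hne⟩)
    omega
  have hnot : ∀ m, W.u m < v → (W.u m < W.l + W.r ∨ w ≤ W.u m) → m ∉ F ∪ G := by
    intro m h1 h2 hm
    simp only [F, G, Finset.mem_filter, Finset.mem_union, Finset.mem_range] at hm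
    omega
  have hS := W.le_card_forward (lo := lo) hk hhi
  have hv : visitBound W.p W.c k (hi - lo) ≤ k := min_le_left _ _
  have hS' := card_le_of_pairs (E := W.exc \ (F ∪ G)) (k := k)
    (S := (Finset.range (W.p - k)).filter fun m => lo ≤ W.u m ∧ W.u m < hi)
    (by
      intro m hm
      simp only [Finset.mem_filter, Finset.mem_range] at hm
      obtain ⟨q1, q2, q3, q4, q5, -⟩ := hpair m (by omega) hm.2.1 hm.2.2
      simp only [Finset.mem_sdiff]
      have := hnot m q2 q3
      have := hnot (m + k) q4 q5
      tauto)
    (by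
      intro m hm hm'
      simp only [Finset.mem_filter, Finset.mem_range] at hm hm'
      exact (hpair m (by omega) hm.2.1 hm.2.2).2.2.2.2.2 hm'.2)
  have h1 := Finset.card_sdiff_add_card_eq_card hsub
  have h2 := Finset.card_union_of_disjoint hFG
  omega

/-- Because l, r ≤ c, both displacements are nonnegative and nothing wraps. A pair landing in a row
between max(l, r) and ⌊s⌋ must contain an exception, as `upper` would force that row above s. In the
count ⌊s⌋ cancels against the top rows above the window. -/
theorem Extremal.false_of_box_one (h : W.Extremal) (hp : 11 ≤ W.p) (hc : 3 * W.c ≤ W.p + 2)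
    (hc' : W.p ≤ 3 * W.c + 2) (hbox : W.Box 1 W.c) : False := by
  have e := h.exc_card
  have le := h.le
  have hs := h.s_lt
  have h3 := p_mod_three hp
  have hmm : min W.l W.r + max W.l W.r = W.l + W.r := min_add_max _ _
  have hle : min W.l W.r ≤ max W.l W.r := min_le_max
  have hn : ⌊W.s⌋₊ < W.l + W.r + W.exc.card := by
    rw [Nat.floor_lt W.s_nonneg]; exact_mod_cast hs
  obtain ⟨A, B, hA, hB, hAB, ⟨z1, hz1⟩, z2, hz2⟩ := hbox
  rw [abs_lt] at hA hB
  have hcl : (W.l : ℝ) ≤ W.c := by exact_mod_cast (by omega : W.l ≤ W.c)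
  have hcr : (W.r : ℝ) ≤ W.c := by exact_mod_cast (by omega : W.r ≤ W.c)
  have hl2 : 2 * (W.l : ℝ) < W.p := by exact_mod_cast W.two_l
  have hr2 : 2 * (W.r : ℝ) < W.p := by exact_mod_cast W.two_r
  have hcard := card_exc_ge (W := W) (k := 1) (lo := max W.l W.r + W.c)
    (hi := ⌊W.s⌋₊ + 1 + W.c) (v := ⌊W.s⌋₊ + (W.l + W.r) + 1) (w := 0) (by omega) (by omega)
    (by omega) (by omega) (by omega) (by
      intro m hm hlo hhi
      have hu := u_eq_of_congr hm (t := W.c) (z := 0) (by push_cast; ring) (by omega)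
        (by have := W.u_lt m (by omega); omega)
      refine ⟨?_, by omega, by omega, by omega, by omega, by omega⟩
      by_contra hne
      push Not at hne
      obtain ⟨t1, t2, t3⟩ := W.top (by omega) hne.1 (by omega)
      have x0 := W.x_nonneg m (by omega)
      have y0 := W.y_nonneg m (by omega)
      obtain ⟨w1, hw1⟩ := W.x_step m 1 hm
      obtain ⟨w2, hw2⟩ := W.y_step m 1 hm
      have hx := eq_of_congr (b := W.x m + A) (z := w1 + z1) (W.x_nonneg _ hm) (W.x_lt _ hm)
        (by linarith) (by linarith) (by rw [hw1, hz1]; push_cast; ring)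
      have hy := eq_of_congr (b := W.y m + B) (z := w2 + z2) (W.y_nonneg _ hm) (W.y_lt _ hm)
        (by linarith) (by linarith) (by rw [hw2, hz2]; push_cast; ring)
      have hu' : (W.u (m + 1) : ℝ) = W.u m - W.c := by exact_mod_cast hu
      have hsum : W.x (m + 1) + W.y (m + 1) + W.u (m + 1) = W.s + W.l + W.r := by
        rw [hx, hy, hu']; linarith
      obtain ⟨f1, f2⟩ := W.upper hm hne.2 (by omega) hsum
      have : ⌊W.s⌋₊ < W.u (m + 1) := by
        rw [Nat.floor_lt W.s_nonneg]; linarith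
      omega)
  exact h.false_of_near_third hp hc hc' (by omega)

theorem Extremal.false_of_box_two (h : W.Extremal) (hp : 11 ≤ W.p) (hc : 3 * W.c ≤ W.p + 2)
    (hc' : W.p ≤ 3 * W.c + 2) (hbox : W.Box 2 (2 * W.c - W.p)) : False := by
  have e := h.exc_card
  have le := h.le
  have hs := h.s_lt
  have h3 := p_mod_three hp
  have hmm : min W.l W.r + max W.l W.r = W.l + W.r := min_add_max _ _
  have hle : min W.l W.r ≤ max W.l W.r := min_le_max
  have hn : ⌊W.s⌋₊ < W.l + W.r + W.exc.card := by
    rw [Nat.floor_lt W.s_nonneg]; exact_mod_cast hs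
  by_cases hC : 2 * W.c + max W.l W.r ≤ W.p
  · obtain ⟨A, B, hA, hB, hAB, ⟨z1, hz1⟩, z2, hz2⟩ := hbox
    rw [abs_lt] at hA hB
    have hcl : 2 * (W.c : ℝ) + W.l ≤ W.p := by exact_mod_cast (by omega : 2 * W.c + W.l ≤ W.p)
    have hcr : 2 * (W.c : ℝ) + W.r ≤ W.p := by exact_mod_cast (by omega : 2 * W.c + W.r ≤ W.p)
    have hl2 : 2 * (W.l : ℝ) < W.p := by exact_mod_cast W.two_l
    have hr2 : 2 * (W.r : ℝ) < W.p := by exact_mod_cast W.two_r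
    have hcard := card_exc_ge (W := W) (k := 2)
      (lo := 2 * W.c + (⌊W.s⌋₊ + (W.l + W.r) + 1 - W.p)) (hi := 2 * W.c + min W.l W.r)
      (v := max (⌊W.s⌋₊ + (W.l + W.r) + 1) (2 * W.c + min W.l W.r)) (w := ⌊W.s⌋₊ + 1)
      (by omega) (by omega) (by omega) (by omega) (by omega) (by
        intro m hm hlo hhi
        have hu := u_eq_of_congr hm (t := 2 * W.c) (z := 0) (by push_cast; ring) (by omega)
          (by have := W.u_lt m (by omega); omega)
        refine ⟨?_, by omega, by omega, by omega, by omega, by omega⟩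
        by_contra hne
        push Not at hne
        obtain ⟨t1, t2, t3⟩ := W.top (by omega) hne.1 (by omega)
        have x0 := W.x_nonneg m (by omega)
        have y0 := W.y_nonneg m (by omega)
        have x1 := W.x_nonneg _ hm
        have y1 := W.y_nonneg _ hm
        obtain ⟨w1, hw1⟩ := W.x_step m 2 hm
        obtain ⟨w2, hw2⟩ := W.y_step m 2 hm
        have hx : W.x (m + 2) = W.x m + A ∨ W.x (m + 2) = W.x m + A + W.p := by
          rcases le_or_gt 0 (W.x m + A) with g | g
          · left
            exact eq_of_congr x1 (W.x_lt _ hm) g (by linarith) (z := w1 + z1)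
              (by rw [hw1, hz1]; push_cast; ring)
          · right
            exact eq_of_congr x1 (W.x_lt _ hm) (by linarith) (by linarith) (z := w1 + z1 - 1)
              (by rw [hw1, hz1]; push_cast; ring)
        have hy : W.y (m + 2) = W.y m + B ∨ W.y (m + 2) = W.y m + B + W.p := by
          rcases le_or_gt 0 (W.y m + B) with g | g
          · left
            exact eq_of_congr y1 (W.y_lt _ hm) g (by linarith) (z := w2 + z2)
              (by rw [hw2, hz2]; push_cast; ring)
          · right
            exact eq_of_congr y1 (W.y_lt _ hm) (by linarith) (by linarith) (z := w2 + z2 - 1)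
              (by rw [hw2, hz2]; push_cast; ring)
        have hu' : (W.u (m + 2) : ℝ) = W.u m - 2 * W.c := by exact_mod_cast hu
        have hbig : W.s + (W.l + W.r) < W.u (m + 2) + W.p := by
          have f1 := Nat.lt_floor_add_one W.s
          have f2 : (⌊W.s⌋₊ + 1 + (W.l + W.r) : ℝ) ≤ W.u (m + 2) + W.p := by
            have : ⌊W.s⌋₊ + 1 + (W.l + W.r) ≤ W.u (m + 2) + W.p := by omega
            exact_mod_cast this
          linarith
        -- Both A and B are negative. The first alternative of `bottom` would make the sum negative,
        -- by `hbig`. The second needs exactly one coordinate to wrap, and the other one, having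
        -- decreased, is still below its side.
        rcases W.bottom hm hne.2 (by omega) with ⟨b1, -⟩ | ⟨b1, b2, b3⟩ <;>
          rcases hx with hx | hx <;> rcases hy with hy | hy <;> linarith)
    -- If the window ends below p, the count leaves only p = 13 and l = r = 3, where `c_eq` gives c
    -- = 4, and the count is then violated.
    by_cases hwin : ⌊W.s⌋₊ + (W.l + W.r) + 1 ≤ W.p
    · have hb3 : max W.l W.r ≤ 3 := by omega
      have hp13 : W.p = 13 := by omega
      have ha3 : min W.l W.r = 3 := by omega
      have hc4 := W.c_eq
      rw [hp13, ha3, show max W.l W.r = 3 by omega] at hc4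
      norm_num at hc4
      omega
    · exact h.false_of_near_third hp hc hc' (by omega)
  · have hc3 : 3 * W.c = W.p + 2 := by omega
    have hb3 : 3 * max W.l W.r + 1 = W.p := by omega
    have hlr : (W.l * W.r : ℤ) = (min W.l W.r : ℕ) * (max W.l W.r : ℕ) := by
      exact_mod_cast (min_mul_max W.l W.r).symm
    -- Here 3c ≡ 2 and 3 max(l, r) ≡ -1 modulo p, so c ≡ ±lr becomes min(l, r) ≡ ∓2.
    have key : (W.p : ℤ) ∣ 2 + (min W.l W.r : ℕ) ∨ (W.p : ℤ) ∣ 2 - (min W.l W.r : ℕ) := by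
      zify at hc3 hb3
      rcases W.rel with ⟨z, hz⟩ | ⟨z, hz⟩
      · left
        refine ⟨3 * z - 1 + (min W.l W.r : ℕ), ?_⟩
        rw [hlr] at hz
        push_cast at hz ⊢
        linear_combination 3 * hz - hc3 + min (W.l : ℤ) W.r * hb3
      · right
        refine ⟨3 * z - 1 - (min W.l W.r : ℕ), ?_⟩
        rw [hlr] at hz
        push_cast at hz ⊢
        linear_combination 3 * hz - hc3 - min (W.l : ℤ) W.r * hb3
    rcases key with key | key
    · have := Int.le_of_dvd (by omega) key
      omega
    · have := Int.eq_zero_of_abs_lt_dvd key (by rw [abs_lt]; omega)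
      omega

theorem Extremal.not_near_third (h : W.Extremal) (hp : 11 ≤ W.p) :
    ¬ (3 * W.c ≤ W.p + 2 ∧ W.p ≤ 3 * W.c + 2) := by
  rintro ⟨hc, hc'⟩
  have e := h.exc_card
  have le := h.le
  have hmm : min W.l W.r + max W.l W.r = W.l + W.r := min_add_max _ _
  obtain ⟨m, hm, hm' | hm'⟩ := h.exists_close_pair hp hc hc'
  · obtain ⟨⟨h1, h2, -⟩, h3⟩ := W.mem_reg.mp hm
    obtain ⟨⟨h1', h2', -⟩, h3'⟩ := W.mem_reg.mp hm'
    have hu := u_eq_of_congr h1' (t := W.c) (z := 0) (by push_cast; ring) (by omega)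
        (by have := W.u_lt m (by omega); omega)
    have hb := W.box_of_pair h1' h3 h3' h2 h2'
    have : (W.u (m + 1) : ℝ) = W.u m - W.c := by exact_mod_cast hu
    rw [this, sub_sub_cancel] at hb
    exact h.false_of_box_one hp hc hc' hb
  · obtain ⟨⟨h1, h2, -⟩, h3⟩ := W.mem_reg.mp hm
    obtain ⟨⟨h1', h2', -⟩, h3'⟩ := W.mem_reg.mp hm'
    have hlt := W.u_lt m h1
    by_cases h2c : 2 * W.c ≤ W.u m
    · have hu := u_eq_of_congr h1' (t := 2 * W.c) (z := 0) (by push_cast; ring) (by omega)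
        (by omega)
      omega
    · have hu := u_eq_of_congr h1' (t := 2 * W.c - W.p) (z := 1) (by push_cast; ring) (by omega)
        (by omega)
      have hb := W.box_of_pair h1' h3 h3' h2 h2'
      have : (W.u (m + 2) : ℝ) = W.u m - (2 * W.c - W.p) := by exact_mod_cast hu
      rw [this, sub_sub_cancel] at hb
      exact h.false_of_box_two hp hc hc' hb

end CircleWalk

/-! ### The prime 7 and the bound for walks. -/

namespace CircleWalk

variable {W : CircleWalk}

theorem HalfTurn.false_of_seven (h : W.HalfTurn 1) (hp : W.p = 7) (hl : W.l = 2) (hr : W.r = 2)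
    (hc : W.c = 3) (hE : W.exc = ∅) : False := by
  obtain ⟨A, B, hA, hB, hAB, ha, hb⟩ := h
  have hno : ∀ m, m ∉ W.exc := by simp [hE]
  rcases le_total 0 B with hB0 | hB0
  · obtain ⟨m, hm, hu⟩ := W.exists_row (v := 5) (by omega)
    obtain ⟨n, hn, hv⟩ := W.exists_row (v := 6) (by omega)
    have hmn : m ≠ n := by rintro rfl; omega
    have : ∀ i, i + 1 < W.p → 5 ≤ W.u i → False := fun i hi hui => by
      have := mem_exc_forward (by rw [hp, hl, hr]; norm_num) hA hB hAB ha hb hB0 hi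
        (by rw [hl, hc]; omega) (by rw [hl, hr, hc]; omega)
      have := hno i
      have := hno (i + 1)
      tauto
    rcases lt_or_ge (m + 1) W.p with h | h
    · exact this m h (by omega)
    · exact this n (by omega) (by omega)
  · have hback : ∀ i, i + 1 < W.p → 6 ≤ W.u (i + 1) → False := fun i hi hui => by
      have := mem_exc_backward (by rw [hp, hl, hr]; norm_num) hA hB hAB ha hb hB0 hi
        (by rw [hl, hp, hc]; omega) (by rw [hl, hr, hp, hc]; omega)
      have := hno i
      have := hno (i + 1)
      tauto
    obtain ⟨n, hn, hv⟩ := W.exists_row (v := 6) (by omega)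
    -- Row 6 has no admissible predecessor, so the walk starts there; its rows at the indices 3 and
    -- 4 are then 4 and 1, and this step from a top row to a bottom row is contradictory.
    have hn0 : n = 0 := by
      by_contra hne
      obtain ⟨i, rfl⟩ := Nat.exists_eq_succ_of_ne_zero hne
      exact hback i hn (by simp only [Nat.succ_eq_add_one] at hv; omega)
    subst hn0
    have h3 : (W.u (0 + 3) : ℤ) = W.u 0 - 2 := u_eq_of_congr (by omega) (z := 1)
      (by rw [hc, hp]; norm_num) (by omega) (by omega)
    have h4 : (W.u (3 + 1) : ℤ) = W.u 3 - 3 := u_eq_of_congr (by omega) (z := 0)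
      (by rw [hc]; norm_num) (by simp only [zero_add] at h3; omega)
      (by simp only [zero_add] at h3; omega)
    rw [zero_add] at h3
    obtain ⟨t1, t2, t3⟩ := W.top (m := 3) (by omega) (hno _) (by omega)
    have hm : 3 + 1 < W.p := by omega
    have x0 := W.x_nonneg 3 (by omega)
    have y0 := W.y_nonneg 3 (by omega)
    have x1 := W.x_nonneg _ hm
    have y1 := W.y_nonneg _ hm
    obtain ⟨w1, hw1⟩ := W.x_step 3 1 hm
    obtain ⟨w2, hw2⟩ := W.y_step 3 1 hm
    obtain ⟨z1, hz1⟩ := ha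
    obtain ⟨z2, hz2⟩ := hb
    rw [abs_lt] at hA hB
    have hp' : (W.p : ℝ) = 7 := by rw [hp]; norm_num
    have hl' : (W.l : ℝ) = 2 := by rw [hl]; norm_num
    have hr' : (W.r : ℝ) = 2 := by rw [hr]; norm_num
    have hc' : (W.c : ℝ) = 3 := by rw [hc]; norm_num
    have hu' : (W.u (3 + 1) : ℝ) = W.u 3 - 3 := by exact_mod_cast h4
    push_cast at hAB
    have hx := eq_of_congr (b := W.x 3 + (A + W.p) / 2) (z := w1 + z1) x1 (W.x_lt _ hm)
      (by linarith) (by linarith) (by rw [hw1, hz1]; push_cast; ring)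
    have hy : W.y (3 + 1) = W.y 3 + B / 2 ∨ W.y (3 + 1) = W.y 3 + B / 2 + W.p := by
      rcases le_or_gt 0 (W.y 3 + B / 2) with g | g
      · left
        exact eq_of_congr y1 (W.y_lt _ hm) g (by linarith) (z := w2 + z2)
          (by rw [hw2, hz2]; push_cast; ring)
      · right
        exact eq_of_congr y1 (W.y_lt _ hm) (by linarith) (by linarith) (z := w2 + z2 - 1)
          (by rw [hw2, hz2]; push_cast; ring)
    rcases W.bottom hm (hno _) (by rw [hl, hr]; omega) with ⟨b1, -⟩ | ⟨b1, b2, b3⟩ <;>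
      rcases hy with hy | hy <;> linarith

theorem Extremal.p_ne_seven (h : W.Extremal) : W.p ≠ 7 := by
  intro hp
  have e := h.exc_card
  have le := h.le
  have hmax : max W.l W.r = 2 := by omega
  have hmin : min W.l W.r = 2 := by omega
  have hl : W.l = 2 := by omega
  have hr : W.r = 2 := by omega
  have hc := W.c_eq
  rw [hmax, hmin, hp] at hc
  norm_num at hc
  have hE : W.exc = ∅ := by rw [← Finset.card_eq_zero]; omega
  have hbox : W.Box (2 * 1) (2 * (1 : ℕ) * W.c - W.p) := by
    have := exists_box (W := W) (k := 2 * 1) (by omega) (t := -1) (z := 1)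
      (by rw [hc, hp]; norm_num) (lo := 4) (hi := 6) (by omega) (by omega) (by omega) (by omega)
      (by rw [hE, hc, hp]; decide)
    rw [hc, hp]
    norm_num at this ⊢
    exact this
  rcases hbox.halfTurn with h' | h'
  · exact h'.false_of_seven hp hl hr hc hE
  · exact h'.false_of_seven (W := W.swap) hp hr hl hc (by rw [swap_exc]; exact hE)

theorem not_extremal : ¬ W.Extremal := by
  intro h
  have e := h.exc_card
  have le := h.le
  by_cases hp : 11 ≤ W.p
  · rcases h.c_cases hp with hc | hc
    · exact h.c_ne_one hp hc
    · exact h.not_near_third hp hc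
  · have h7 := h.p_ne_seven
    have hpr := W.prime
    have : W.p = 4 ∨ W.p = 8 ∨ W.p = 9 ∨ W.p = 10 ∨ W.p = 2 ∨ W.p = 3 ∨ W.p = 5 ∨ W.p = 6 := by
      have := hpr.two_le
      omega
    rcases this with hp | hp | hp | hp | hp | hp | hp | hp
    · rw [hp] at hpr; revert hpr; norm_num
    · rw [hp] at hpr; revert hpr; norm_num
    · rw [hp] at hpr; revert hpr; norm_num
    · rw [hp] at hpr; revert hpr; norm_num
    all_goals omega

/-- The total of the second differences along a walk is at most `2 p / 3` in absolute value. -/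
theorem total_le (W : CircleWalk) : 3 * W.total ≤ 2 * W.p :=
  not_lt.mp (W.not_extremal)

/-- Even if all p indices were exceptional, the total would be -max(l, r) > -p/2. -/
theorem le_total (W : CircleWalk) : -(2 * (W.p : ℤ)) ≤ 3 * W.total := by
  by_contra h
  have h1 := W.total_eq
  have h2 : W.exc.card ≤ W.p := (Finset.card_filter_le _ _).trans (by simp)
  have := W.two_l
  have := W.two_r
  omega

end CircleWalk

/-! ### Moving rectangles and their symmetries. -/

/-- The alternating sum of the indicators of `x + y ≤ s` over the corners of a rectangle. -/
noncomputable def cornerDiff (s x x' y y' : ℝ) : ℤ :=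
  (if x + y ≤ s then 1 else 0) - (if x' + y ≤ s then 1 else 0) - (if x + y' ≤ s then 1 else 0)
    + (if x' + y' ≤ s then 1 else 0)

theorem cornerDiff_flip (s x x' y y' : ℝ) : cornerDiff s x' x y y' = -cornerDiff s x x' y y' := by
  unfold cornerDiff; ring

theorem cornerDiff_comm (s x x' y y' : ℝ) : cornerDiff s y y' x x' = cornerDiff s x x' y y' := by
  unfold cornerDiff
  rw [add_comm y x, add_comm y' x, add_comm y x', add_comm y' x']
  ring

/-- A moving rectangle on the product of two circles of length `p`. -/
structure RectangleWalk where
  p : ℕ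
  l : ℕ
  r : ℕ
  c : ℕ
  s : ℝ
  a : ℝ
  b : ℝ
  x : ℕ → ℝ
  x' : ℕ → ℝ
  y : ℕ → ℝ
  y' : ℕ → ℝ
  u : ℕ → ℤ
  prime : p.Prime
  odd : p % 2 = 1
  l_le : l ≤ p
  r_le : r ≤ p
  c_pos : 0 < c
  c_lt : c < p
  rel : (p : ℤ) ∣ c - l * r ∨ (p : ℤ) ∣ c + l * r
  s_nonneg : 0 ≤ s
  s_lt : s < p
  x_mem : ∀ m < p, 0 ≤ x m ∧ x m < p
  x'_mem : ∀ m < p, 0 ≤ x' m ∧ x' m < p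
  y_mem : ∀ m < p, 0 ≤ y m ∧ y m < p
  y'_mem : ∀ m < p, 0 ≤ y' m ∧ y' m < p
  x_side : ∀ m < p, ∃ z : ℤ, x' m = x m + l + p * z
  y_side : ∀ m < p, ∃ z : ℤ, y' m = y m + r + p * z
  x_step : ∀ m k, m + k < p → ∃ z : ℤ, x (m + k) = x m + k * a + p * z
  y_step : ∀ m k, m + k < p → ∃ z : ℤ, y (m + k) = y m + k * b + p * z
  step_sum : ∃ z : ℤ, a + b = c + p * z
  sum : ∀ m < p, ∃ z : ℤ, x m + y m + u m = s + p * z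

namespace RectangleWalk

variable (R : RectangleWalk)

/-- The sum of the corner differences. -/
noncomputable def total : ℤ :=
  ∑ m ∈ Finset.range R.p, cornerDiff R.s (R.x m) (R.x' m) (R.y m) (R.y' m)

/-- The two coordinates exchanged. -/
def swap : RectangleWalk where
  p := R.p
  l := R.r
  r := R.l
  c := R.c
  s := R.s
  a := R.b
  b := R.a
  x := R.y
  x' := R.y'
  y := R.x
  y' := R.x'
  u := R.u
  prime := R.prime
  odd := R.odd
  l_le := R.r_le
  r_le := R.l_le
  c_pos := R.c_pos
  c_lt := R.c_lt
  rel := by rw [mul_comm]; exact R.rel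
  s_nonneg := R.s_nonneg
  s_lt := R.s_lt
  x_mem := R.y_mem
  x'_mem := R.y'_mem
  y_mem := R.x_mem
  y'_mem := R.x'_mem
  x_side := R.y_side
  y_side := R.x_side
  x_step := R.y_step
  y_step := R.x_step
  step_sum := by rw [add_comm]; exact R.step_sum
  sum := fun m h => by
    obtain ⟨z, hz⟩ := R.sum m h
    exact ⟨z, by linarith⟩

/-- The two ends of the first side exchanged. -/
def flip : RectangleWalk :=
  { R with
    l := R.p - R.l
    x := R.x'
    x' := R.x
    u := fun m => R.u m - R.l
    l_le := Nat.sub_le _ _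
    rel := by
      have h := R.l_le
      rcases R.rel with ⟨z, hz⟩ | ⟨z, hz⟩
      · refine Or.inr ⟨z + R.r, ?_⟩
        push_cast [Nat.cast_sub h]
        linear_combination hz
      · refine Or.inl ⟨z - R.r, ?_⟩
        push_cast [Nat.cast_sub h]
        linear_combination hz
    x_mem := R.x'_mem
    x'_mem := R.x_mem
    x_side := fun m h => by
      obtain ⟨z, hz⟩ := R.x_side m h
      refine ⟨-z - 1, ?_⟩
      rw [hz, Nat.cast_sub R.l_le]
      push_cast; ring
    x_step := fun m k h => by
      obtain ⟨z, hz⟩ := R.x_step m k h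
      obtain ⟨z1, hz1⟩ := R.x_side m (by omega)
      obtain ⟨z2, hz2⟩ := R.x_side _ h
      refine ⟨z + z2 - z1, ?_⟩
      rw [hz2, hz, hz1]
      push_cast; ring
    sum := fun m h => by
      obtain ⟨z, hz⟩ := R.sum m h
      obtain ⟨z1, hz1⟩ := R.x_side m h
      refine ⟨z + z1, ?_⟩
      rw [hz1]
      push_cast; linarith }

/-- The walk in the reverse direction. -/
def reverse : RectangleWalk :=
  { R with
    c := R.p - R.c
    a := -R.a
    b := -R.b
    x := fun m => R.x (R.p - 1 - m)
    x' := fun m => R.x' (R.p - 1 - m)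
    y := fun m => R.y (R.p - 1 - m)
    y' := fun m => R.y' (R.p - 1 - m)
    u := fun m => R.u (R.p - 1 - m)
    c_pos := Nat.sub_pos_of_lt R.c_lt
    c_lt := Nat.sub_lt R.prime.pos R.c_pos
    rel := by
      have h := R.c_lt.le
      rcases R.rel with ⟨z, hz⟩ | ⟨z, hz⟩
      · refine Or.inr ⟨1 - z, ?_⟩
        push_cast [Nat.cast_sub h]
        linear_combination -hz
      · refine Or.inl ⟨1 - z, ?_⟩
        push_cast [Nat.cast_sub h]
        linear_combination -hz
    x_mem := fun m h => R.x_mem _ (by omega)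
    x'_mem := fun m h => R.x'_mem _ (by omega)
    y_mem := fun m h => R.y_mem _ (by omega)
    y'_mem := fun m h => R.y'_mem _ (by omega)
    x_side := fun m h => R.x_side _ (by omega)
    y_side := fun m h => R.y_side _ (by omega)
    x_step := fun m k h => by
      obtain ⟨z, hz⟩ := R.x_step (R.p - 1 - (m + k)) k (by omega)
      rw [show R.p - 1 - (m + k) + k = R.p - 1 - m by omega] at hz
      exact ⟨-z, by rw [hz]; push_cast; ring⟩
    y_step := fun m k h => by
      obtain ⟨z, hz⟩ := R.y_step (R.p - 1 - (m + k)) k (by omega)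
      rw [show R.p - 1 - (m + k) + k = R.p - 1 - m by omega] at hz
      exact ⟨-z, by rw [hz]; push_cast; ring⟩
    step_sum := by
      obtain ⟨z, hz⟩ := R.step_sum
      refine ⟨-z - 1, ?_⟩
      rw [Nat.cast_sub R.c_lt.le]
      push_cast; linarith
    sum := fun m h => R.sum _ (by omega) }

theorem swap_total : R.swap.total = R.total := by
  unfold total
  simp only [swap, cornerDiff_comm]

theorem flip_total : R.flip.total = -R.total := by
  unfold total
  simp only [flip]
  rw [← Finset.sum_neg_distrib]
  exact Finset.sum_congr rfl fun m _ => cornerDiff_flip _ _ _ _ _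

theorem reverse_total : R.reverse.total = R.total :=
  Finset.sum_range_reflect (fun m => cornerDiff R.s (R.x m) (R.x' m) (R.y m) (R.y' m)) R.p

/-- The walk of the far corner of the rectangle. -/
def toCircleWalk (hl : 2 * R.l < R.p) (hr : 2 * R.r < R.p) (hc : 2 * R.c < R.p) : CircleWalk where
  p := R.p
  l := R.l
  r := R.r
  c := R.c
  s := R.s
  a := R.a
  x := R.x'
  y := R.y'
  u := fun m => (R.u m % R.p).toNat
  prime := R.prime
  two_l := hl
  two_r := hr
  c_pos := R.c_pos
  two_c := hc
  rel := R.rel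
  s_nonneg := R.s_nonneg
  s_lt := R.s_lt
  x_nonneg := fun m h => (R.x'_mem m h).1
  x_lt := fun m h => (R.x'_mem m h).2
  y_nonneg := fun m h => (R.y'_mem m h).1
  y_lt := fun m h => (R.y'_mem m h).2
  u_lt := fun m h => by
    have := Int.emod_lt_of_pos (R.u m) (show (0 : ℤ) < R.p by omega)
    omega
  x_step := fun m k h => by
    obtain ⟨z, hz⟩ := R.x_step m k h
    obtain ⟨z1, hz1⟩ := R.x_side m (by omega)
    obtain ⟨z2, hz2⟩ := R.x_side _ h
    refine ⟨z + z2 - z1, ?_⟩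
    rw [hz2, hz, hz1]
    push_cast; ring
  y_step := fun m k h => by
    obtain ⟨z, hz⟩ := R.y_step m k h
    obtain ⟨z1, hz1⟩ := R.y_side m (by omega)
    obtain ⟨z2, hz2⟩ := R.y_side _ h
    obtain ⟨z3, hz3⟩ := R.step_sum
    refine ⟨z + z2 - z1 + k * z3, ?_⟩
    rw [hz2, hz, hz1, show R.b = R.c + R.p * z3 - R.a by linarith]
    push_cast; ring
  sum := fun m h => by
    obtain ⟨z, hz⟩ := R.sum m h
    obtain ⟨z1, hz1⟩ := R.x_side m h
    obtain ⟨z2, hz2⟩ := R.y_side m h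
    have h1 : ((R.u m % R.p).toNat : ℤ) = R.u m - R.p * (R.u m / R.p) := by
      rw [Int.toNat_of_nonneg (Int.emod_nonneg _ (by omega)), Int.emod_def]
    have h2 : ((R.u m % R.p).toNat : ℝ) = R.u m - R.p * (R.u m / R.p : ℤ) := by
      exact_mod_cast h1
    refine ⟨z + z1 + z2 - R.u m / R.p, ?_⟩
    rw [hz1, hz2, h2]
    push_cast; linarith

theorem shiftDown_eq {p l : ℕ} {x x' : ℝ} (hx : 0 ≤ x ∧ x < p) (hx' : 0 ≤ x' ∧ x' < p)
    (hl : l ≤ p) {z : ℤ} (h : x' = x + l + p * z) : shiftDown p l x' = x := by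
  have hl' : (l : ℝ) ≤ p := by exact_mod_cast hl
  have h0 : (0 : ℝ) ≤ l := Nat.cast_nonneg l
  unfold shiftDown
  split_ifs with hle
  · exact eq_of_congr (by linarith) (by linarith) hx.1 hx.2 (z := z) (by linarith)
  · exact eq_of_congr (by linarith) (by linarith) hx.1 hx.2 (z := z + 1) (by push_cast; linarith)

theorem toCircleWalk_total (hl : 2 * R.l < R.p) (hr : 2 * R.r < R.p) (hc : 2 * R.c < R.p) :
    (R.toCircleWalk hl hr hc).total = R.total := by
  unfold total CircleWalk.total
  refine Finset.sum_congr rfl fun m hm => ?_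
  have hm' := Finset.mem_range.mp hm
  obtain ⟨z1, hz1⟩ := R.x_side m hm'
  obtain ⟨z2, hz2⟩ := R.y_side m hm'
  have h1 := shiftDown_eq (R.x_mem m hm') (R.x'_mem m hm') R.l_le hz1
  have h2 := shiftDown_eq (R.y_mem m hm') (R.y'_mem m hm') R.r_le hz2
  change diffTwo R.p R.l R.r R.s (R.x' m) (R.y' m) = _
  unfold diffTwo cornerDiff
  rw [h1, h2]
  ring

/-- The total of the corner differences is at most `2 p / 3` in absolute value. -/
theorem abs_total_le (R : RectangleWalk) : 3 * |R.total| ≤ 2 * R.p := by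
  -- Since p is odd, one of c, p - c is below p/2, and likewise for l and r. Reversal preserves the
  -- total and a flip negates it, so the absolute value is unaffected.
  have base : ∀ R : RectangleWalk, 2 * R.l < R.p → 2 * R.r < R.p → 2 * R.c < R.p →
      3 * |R.total| ≤ 2 * R.p := fun R hl hr hc => by
    have h1 := (R.toCircleWalk hl hr hc).total_le
    have h2 := (R.toCircleWalk hl hr hc).le_total
    rw [toCircleWalk_total] at h1 h2
    simp only [toCircleWalk] at h1 h2
    rcases abs_cases R.total with ⟨h, -⟩ | ⟨h, -⟩ <;> rw [h] <;> omega
  have direction : ∀ R : RectangleWalk, 2 * R.l < R.p → 2 * R.r < R.p →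
      3 * |R.total| ≤ 2 * R.p := fun R hl hr => by
    by_cases hc : 2 * R.c < R.p
    · exact base R hl hr hc
    · have := base R.reverse hl hr (by
        have := R.odd
        simp only [reverse]
        omega)
      rwa [reverse_total] at this
  have first : ∀ R : RectangleWalk, 2 * R.r < R.p → 3 * |R.total| ≤ 2 * R.p := fun R hr => by
    by_cases hl : 2 * R.l < R.p
    · exact direction R hl hr
    · have := direction R.flip (by
        have := R.odd
        simp only [flip]
        omega) hr
      rwa [flip_total, abs_neg] at this
  by_cases hr : 2 * R.r < R.p
  · exact first R hr
  · have := first R.swap.flip.swap (by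
      have := R.odd
      simp only [flip, swap]
      omega)
    rwa [swap_total, flip_total, swap_total, abs_neg] at this

end RectangleWalk

/-! ### Product formulas for the cyclotomic polynomial. -/

section Identity

open Polynomial

theorem cyclotomic_two_primes_mul {p q : ℕ} (hp : p.Prime) (hq : q.Prime) (hpq : p ≠ q) :
    cyclotomic (p * q) ℤ * ((X ^ p - 1) * (X ^ q - 1)) = (X ^ (p * q) - 1) * (X - 1) := by
  have := Fact.mk hp
  have h1 := cyclotomic_expand_eq_cyclotomic_mul hq (n := p)
    (fun h => hpq ((Nat.prime_dvd_prime_iff_eq hq hp).mp h).symm) ℤ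
  have h2 := cyclotomic_prime_mul_X_sub_one ℤ p
  have h3 := congrArg (expand ℤ q) h2
  simp only [map_mul, map_sub, map_pow, expand_X, map_one] at h3
  rw [h1, ← pow_mul, mul_comm q p] at h3
  rw [← h2]
  linear_combination (X - 1) * h3

theorem cyclotomic_three_primes_mul {p q r : ℕ} (hp : p.Prime) (hq : q.Prime) (hr : r.Prime)
    (hpq : p ≠ q) (hpr : p ≠ r) (hqr : q ≠ r) :
    cyclotomic (p * q * r) ℤ *
        ((X - 1) * ((X ^ (q * r) - 1) * (X ^ (r * p) - 1) * (X ^ (p * q) - 1))) =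
      (X ^ (p * q * r) - 1) * ((X ^ p - 1) * (X ^ q - 1) * (X ^ r - 1)) := by
  have h1 := cyclotomic_expand_eq_cyclotomic_mul hr (n := p * q) (fun h => by
    rcases (Nat.Prime.dvd_mul hr).mp h with h | h
    · exact hpr ((Nat.prime_dvd_prime_iff_eq hr hp).mp h).symm
    · exact hqr ((Nat.prime_dvd_prime_iff_eq hr hq).mp h).symm) ℤ
  have h2 := cyclotomic_two_primes_mul hp hq hpq
  have h3 := congrArg (expand ℤ r) h2
  simp only [map_mul, map_sub, map_pow, expand_X, map_one] at h3
  rw [h1] at h3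
  simp only [← pow_mul] at h3
  rw [show r * (p * q) = p * q * r by ring, mul_comm r q] at h3
  have h0 : cyclotomic (p * q) ℤ ≠ 0 := cyclotomic_ne_zero _ _
  apply mul_left_cancel₀ h0
  linear_combination (X - 1) * (X ^ (p * q) - 1) * h3 -
    (X ^ (p * q * r) - 1) * (X ^ r - 1) * h2

/-- With M = X^{pqr}, the three factors X^{qr} - 1, X^{rp} - 1, X^{pq} - 1 divide M - 1 with
geometric quotients. The product formula already supplies one M - 1, so two more suffice. -/
theorem cyclotomic_three_primes_mul_sq {p q r : ℕ} (hp : p.Prime) (hq : q.Prime) (hr : r.Prime)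
    (hpq : p ≠ q) (hpr : p ≠ r) (hqr : q ≠ r) :
    cyclotomic (p * q * r) ℤ * (X ^ (p * q * r) - 1) ^ 2 =
      (∑ i ∈ Finset.range p, X ^ i) * ((X ^ q - 1) * (X ^ r - 1)) *
        ∑ t ∈ Finset.range p ×ˢ (Finset.range q ×ˢ Finset.range r),
          X ^ (t.1 * (q * r) + t.2.1 * (r * p) + t.2.2 * (p * q)) := by
  have g0 := geom_sum_mul (X : ℤ[X]) p
  have g1 := geom_sum_mul ((X : ℤ[X]) ^ (q * r)) p
  have g2 := geom_sum_mul ((X : ℤ[X]) ^ (r * p)) q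
  have g3 := geom_sum_mul ((X : ℤ[X]) ^ (p * q)) r
  have hS : ∑ t ∈ Finset.range p ×ˢ (Finset.range q ×ˢ Finset.range r),
      (X : ℤ[X]) ^ (t.1 * (q * r) + t.2.1 * (r * p) + t.2.2 * (p * q)) =
      (∑ i ∈ Finset.range p, (X ^ (q * r)) ^ i) * ((∑ i ∈ Finset.range q, (X ^ (r * p)) ^ i) *
        ∑ i ∈ Finset.range r, (X ^ (p * q)) ^ i) := by
    rw [Finset.sum_mul_sum, ← Finset.sum_product', Finset.sum_mul_sum, ← Finset.sum_product']
    refine Finset.sum_congr rfl fun t _ => ?_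
    simp only [← pow_mul, ← pow_add]
    congr 1
    ring
  have key := cyclotomic_three_primes_mul hp hq hr hpq hpr hqr
  rw [← pow_mul, show q * r * p = p * q * r by ring] at g1
  rw [← pow_mul, show r * p * q = p * q * r by ring] at g2
  rw [← pow_mul] at g3
  rw [hS]
  have hM : ∀ n : ℕ, 0 < n → (X ^ n - 1 : ℤ[X]) ≠ 0 := fun n hn => X_pow_sub_C_ne_zero hn 1
  have h0 : ((X - 1) * (X ^ (p * q * r) - 1) : ℤ[X]) ≠ 0 :=
    mul_ne_zero (by simpa using hM 1 one_pos) (hM _ (by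
      have := hp.pos; have := hq.pos; have := hr.pos; positivity))
  apply mul_right_cancel₀ h0
  generalize (∑ i ∈ Finset.range p, ((X : ℤ[X]) ^ (q * r)) ^ i) = S1 at *
  generalize (∑ i ∈ Finset.range q, ((X : ℤ[X]) ^ (r * p)) ^ i) = S2 at *
  generalize (∑ i ∈ Finset.range r, ((X : ℤ[X]) ^ (p * q)) ^ i) = S3 at *
  generalize (∑ i ∈ Finset.range p, (X : ℤ[X]) ^ i) = S0 at *
  generalize cyclotomic (p * q * r) ℤ = f at *
  generalize (X : ℤ[X]) ^ (p * q * r) = M at *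
  generalize (X : ℤ[X]) ^ (q * r) = a1 at *
  generalize (X : ℤ[X]) ^ (r * p) = a2 at *
  generalize (X : ℤ[X]) ^ (p * q) = a3 at *
  generalize (X : ℤ[X]) ^ p = b1 at *
  calc f * (M - 1) ^ 2 * ((X - 1) * (M - 1))
      = f * ((X - 1) * ((M - 1) * (M - 1) * (M - 1))) := by ring
    _ = f * ((X - 1) * ((a1 - 1) * (a2 - 1) * (a3 - 1))) * (S1 * (S2 * S3)) := by
        rw [← g1] ; nth_rw 2 [show S1 * (a1 - 1) = S2 * (a2 - 1) by rw [g1, g2]]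
        nth_rw 2 [show S1 * (a1 - 1) = S3 * (a3 - 1) by rw [g1, g3]]
        ring
    _ = _ := by rw [key, ← g0]; ring

end Identity

/-! ### Coefficients as sums of second differences. -/

/-- The number of representations of `k` as `a q r + b r p + c p q` with `a < p`, `b < q` and
`c < r`. -/
def reprCount (p q r : ℕ) (k : ℤ) : ℤ :=
  ∑ t ∈ Finset.range p ×ˢ (Finset.range q ×ˢ Finset.range r),
    if ((t.1 * (q * r) + t.2.1 * (r * p) + t.2.2 * (p * q) : ℕ) : ℤ) = k then 1 else 0

section Coefficients

open Polynomial

theorem coeff_shift_reprCount (p q r e n : ℕ) :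
    (X ^ e * ∑ t ∈ Finset.range p ×ˢ (Finset.range q ×ˢ Finset.range r),
      (X : ℤ[X]) ^ (t.1 * (q * r) + t.2.1 * (r * p) + t.2.2 * (p * q))).coeff n =
      reprCount p q r (n - e) := by
  rw [Finset.mul_sum, finsetSum_coeff, reprCount]
  refine Finset.sum_congr rfl fun t _ => ?_
  rw [← pow_add, coeff_X_pow]
  refine if_congr ?_ rfl rfl
  omega

theorem coeff_cyclotomic_three_primes {p q r : ℕ} (hp : p.Prime) (hq : q.Prime) (hr : r.Prime)
    (hpq : p ≠ q) (hpr : p ≠ r) (hqr : q ≠ r) {n : ℕ} (hn : n < p * q * r) :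
    (cyclotomic (p * q * r) ℤ).coeff n = ∑ i ∈ Finset.range p,
      (reprCount p q r (n - i) - reprCount p q r (n - i - r) - reprCount p q r (n - i - q) +
        reprCount p q r (n - i - q - r)) := by
  have h := congrArg (fun f => f.coeff n) (cyclotomic_three_primes_mul_sq hp hq hr hpq hpr hqr)
  have h1 : (cyclotomic (p * q * r) ℤ * (X ^ (p * q * r) - 1) ^ 2).coeff n =
      (cyclotomic (p * q * r) ℤ).coeff n := by
    -- With M = X^{pqr}, (M - 1)² = 1 + (M - 2)M, and the multiple of M is invisible below degree
    -- pqr.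
    have : cyclotomic (p * q * r) ℤ * (X ^ (p * q * r) - 1) ^ 2 = cyclotomic (p * q * r) ℤ +
        cyclotomic (p * q * r) ℤ * (X ^ (p * q * r) - 2) * X ^ (p * q * r) := by ring
    rw [this, coeff_add, coeff_mul_X_pow', if_neg (by omega), add_zero]
  rw [h1] at h
  rw [h]
  set S := ∑ t ∈ Finset.range p ×ˢ (Finset.range q ×ˢ Finset.range r),
      (X : ℤ[X]) ^ (t.1 * (q * r) + t.2.1 * (r * p) + t.2.2 * (p * q)) with hS
  rw [mul_assoc, Finset.sum_mul, finsetSum_coeff]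
  refine Finset.sum_congr rfl fun i _ => ?_
  have : X ^ i * ((X ^ q - 1) * (X ^ r - 1) * S) =
      X ^ i * S - X ^ (i + r) * S - X ^ (i + q) * S + X ^ (i + q + r) * S := by ring
  rw [this, coeff_add, coeff_sub, coeff_sub, hS, coeff_shift_reprCount, coeff_shift_reprCount,
    coeff_shift_reprCount, coeff_shift_reprCount]
  push_cast
  simp only [sub_sub]

end Coefficients

/-- The digits of a representation are forced by k modulo p, q, r, and the forced digits represent k
modulo pqr. As k < pqr, the representation is exact as soon as the last two digits contribute at
most k. -/
theorem reprCount_eq {p q r : ℕ} {A B C tA tB tC : ℤ} (hp : 0 < p) (hq : 0 < q) (hr : 0 < r)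
    (hA : q * r * A = 1 + p * tA) (hB : r * p * B = 1 + q * tB) (hC : p * q * C = 1 + r * tC)
    {k : ℤ} (hk : k < p * q * r) :
    reprCount p q r k = if (k * B % q) * (r * p) + (k * C % r) * (p * q) ≤ k then 1 else 0 := by
  have hp' : (0 : ℤ) < p := by exact_mod_cast hp
  have hq' : (0 : ℤ) < q := by exact_mod_cast hq
  have hr' : (0 : ℤ) < r := by exact_mod_cast hr
  have uniq : ∀ t ∈ Finset.range p ×ˢ (Finset.range q ×ˢ Finset.range r),
      ((t.1 * (q * r) + t.2.1 * (r * p) + t.2.2 * (p * q) : ℕ) : ℤ) = k →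
        (t.1 : ℤ) = k * A % p ∧ (t.2.1 : ℤ) = k * B % q ∧ (t.2.2 : ℤ) = k * C % r := by
    rintro ⟨a, b, c⟩ ht hk
    simp only [Finset.mem_product, Finset.mem_range] at ht
    push_cast at hk
    simp only
    refine ⟨?_, ?_, ?_⟩
    · rw [show k * A = a + p * (a * tA + (b * r + c * q) * A) by
        linear_combination -A * hk + a * hA, Int.add_mul_emod_self_left,
        Int.emod_eq_of_lt (by omega) (by omega)]
    · rw [show k * B = b + q * (b * tB + (a * r + c * p) * B) by
        linear_combination -B * hk + b * hB, Int.add_mul_emod_self_left,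
        Int.emod_eq_of_lt (by omega) (by omega)]
    · rw [show k * C = c + r * (c * tC + (a * q + b * p) * C) by
        linear_combination -C * hk + c * hC, Int.add_mul_emod_self_left,
        Int.emod_eq_of_lt (by omega) (by omega)]
  have a0 := Int.emod_nonneg (k * A) hp'.ne'
  have b0 := Int.emod_nonneg (k * B) hq'.ne'
  have c0 := Int.emod_nonneg (k * C) hr'.ne'
  have a1 := Int.emod_lt_of_pos (k * A) hp'
  have b1 := Int.emod_lt_of_pos (k * B) hq'
  have c1 := Int.emod_lt_of_pos (k * C) hr'
  have hrepr : ∃ j : ℤ, (k * A % p) * (q * r) + (k * B % q) * (r * p) + (k * C % r) * (p * q) =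
      k + p * q * r * j := by
    have e1 := Int.emod_def (k * A) p
    have e2 := Int.emod_def (k * B) q
    have e3 := Int.emod_def (k * C) r
    have cpq : IsCoprime (p : ℤ) q := ⟨r * B, -tB, by linear_combination hB⟩
    have cpr : IsCoprime (p : ℤ) r := ⟨q * C, -tC, by linear_combination hC⟩
    have cqr : IsCoprime (q : ℤ) r := ⟨p * C, -tC, by linear_combination hC⟩
    have d1 : (p : ℤ) ∣ (k * A % p) * (q * r) + (k * B % q) * (r * p) + (k * C % r) * (p * q) - k :=
      ⟨k * tA - (k * A / p) * (q * r) + (k * B % q) * r + (k * C % r) * q, by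
        rw [e1]; linear_combination k * hA⟩
    have d2 : (q : ℤ) ∣ (k * A % p) * (q * r) + (k * B % q) * (r * p) + (k * C % r) * (p * q) - k :=
      ⟨k * tB - (k * B / q) * (r * p) + (k * A % p) * r + (k * C % r) * p, by
        rw [e2]; linear_combination k * hB⟩
    have d3 : (r : ℤ) ∣ (k * A % p) * (q * r) + (k * B % q) * (r * p) + (k * C % r) * (p * q) - k :=
      ⟨k * tC - (k * C / r) * (p * q) + (k * A % p) * q + (k * B % q) * p, by
        rw [e3]; linear_combination k * hC⟩
    obtain ⟨j, hj⟩ := IsCoprime.mul_dvd (IsCoprime.mul_left cpr cqr) (cpq.mul_dvd d1 d2) d3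
    exact ⟨j, by linarith⟩
  obtain ⟨j, hj⟩ := hrepr
  generalize k * A % p = a at *
  generalize k * B % q = b at *
  generalize k * C % r = c at *
  lift a to ℕ using a0
  lift b to ℕ using b0
  lift c to ℕ using c0
  split_ifs with hle
  · have hM : (0 : ℤ) < p * q * r := by positivity
    have hbc : (0 : ℤ) ≤ b * (r * p) + c * (p * q) := by positivity
    have hj0 : j = 0 := by
      have h1 : (a : ℤ) * (q * r) + q * r ≤ p * q * r := by
        have : ((a : ℤ) + 1) * (q * r) ≤ p * (q * r) :=
          mul_le_mul_of_nonneg_right (by omega) (by positivity)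
        linarith
      have h2 : (0 : ℤ) < q * r := by positivity
      have h3 : (0 : ℤ) ≤ a * (q * r) := by positivity
      have : j < 1 := by
        by_contra hne
        have : (p * q * r : ℤ) * 1 ≤ p * q * r * j :=
          mul_le_mul_of_nonneg_left (by omega) hM.le
        linarith
      have : -1 < j := by
        by_contra hne
        have : (p * q * r : ℤ) * j ≤ p * q * r * (-1) :=
          mul_le_mul_of_nonneg_left (by omega) hM.le
        linarith
      omega
    rw [hj0, mul_zero, add_zero] at hj
    rw [reprCount, Finset.sum_eq_single (a, b, c)]
    · rw [if_pos]
      push_cast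
      exact hj
    · intro t ht hne
      rw [if_neg]
      intro h
      have := uniq t ht h
      apply hne
      ext <;> simp only <;> omega
    · intro hne
      exfalso
      apply hne
      simp only [Finset.mem_product, Finset.mem_range]
      omega
  · rw [reprCount]
    refine Finset.sum_eq_zero fun t ht => ?_
    rw [if_neg]
    intro h
    obtain ⟨h1, h2, h3⟩ := uniq t ht h
    apply hle
    rw [← h, ← h2, ← h3]
    push_cast
    have : (0 : ℤ) ≤ t.1 * (q * r) := by positivity
    linarith

/-! ### The rectangle walk of a coefficient and the conclusion. -/

theorem exists_inverse {m n : ℕ} (h : Nat.Coprime m n) : ∃ A t : ℤ, m * A = 1 + n * t := by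
  obtain ⟨a, b, hab⟩ := Nat.isCoprime_iff_coprime.mpr h
  exact ⟨a, -b, by linear_combination hab⟩

theorem real_emod_eq (k B : ℤ) {p q : ℝ} {m : ℕ} (hm : q = m) (hq : q ≠ 0) :
    ((k * B % m : ℤ) : ℝ) * p / q = k * (B * p / q) - p * ((k * B / m : ℤ) : ℝ) := by
  have : ((k * B % m : ℤ) : ℝ) = k * B - q * ((k * B / m : ℤ) : ℝ) := by
    rw [hm, Int.emod_def]; push_cast; ring
  rw [this]
  field_simp

set_option maxHeartbeats 2000000 in
/-- The rectangle walk which computes the `n`-th coefficient of the cyclotomic polynomial of order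
`p q r`. -/
theorem exists_rectangleWalk {p q r n : ℕ} (hp : p.Prime) (hp2 : p % 2 = 1) (hq : q.Prime)
    (hr : r.Prime) (hpq : p < q) (hqr : q < r) (hn : n < p * q * r) :
    ∃ R : RectangleWalk, R.p = p ∧ R.total = (Polynomial.cyclotomic (p * q * r) ℤ).coeff n := by
  have cpq : Nat.Coprime p q := (Nat.coprime_primes hp hq).mpr hpq.ne
  have cpr : Nat.Coprime p r := (Nat.coprime_primes hp hr).mpr (hpq.trans hqr).ne
  have cqr : Nat.Coprime q r := (Nat.coprime_primes hq hr).mpr hqr.ne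
  obtain ⟨A, tA, hA⟩ := exists_inverse (Nat.Coprime.mul_left cpq.symm cpr.symm)
  obtain ⟨B, tB, hB⟩ := exists_inverse (Nat.Coprime.mul_left cqr.symm cpq)
  obtain ⟨C, tC, hC⟩ := exists_inverse (Nat.Coprime.mul_left cpr cqr)
  push_cast at hA hB hC
  have hp0 : (0 : ℝ) < p := by exact_mod_cast hp.pos
  have hq0 : (0 : ℝ) < q := by exact_mod_cast hq.pos
  have hr0 : (0 : ℝ) < r := by exact_mod_cast hr.pos
  have hpz : (0 : ℤ) < p := by exact_mod_cast hp.pos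
  have hqz : (0 : ℤ) < q := by exact_mod_cast hq.pos
  have hrz : (0 : ℤ) < r := by exact_mod_cast hr.pos
  have hpq' : (p : ℝ) + 1 ≤ q := by exact_mod_cast hpq
  have hqr' : (q : ℝ) + 1 ≤ r := by exact_mod_cast hqr
  have hp3 : (3 : ℝ) ≤ p := by
    have : 3 ≤ p := by have := hp.two_le; omega
    exact_mod_cast this
  -- Divided by pqr this reads A/p + B/q + C/r ≡ 1/(pqr) modulo 1. It makes x + y congruent to s
  -- minus an integer row.
  obtain ⟨Z, hZ⟩ : ∃ Z : ℤ, A * (q * r) + B * (r * p) + C * (p * q) = 1 + p * q * r * Z := by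
    have d1 : (p : ℤ) ∣ A * (q * r) + B * (r * p) + C * (p * q) - 1 :=
      ⟨tA + B * r + C * q, by linear_combination hA⟩
    have d2 : (q : ℤ) ∣ A * (q * r) + B * (r * p) + C * (p * q) - 1 :=
      ⟨tB + A * r + C * p, by linear_combination hB⟩
    have d3 : (r : ℤ) ∣ A * (q * r) + B * (r * p) + C * (p * q) - 1 :=
      ⟨tC + A * q + B * p, by linear_combination hC⟩
    obtain ⟨j, hj⟩ := IsCoprime.mul_dvd (IsCoprime.mul_left (Nat.isCoprime_iff_coprime.mpr cpr)
      (Nat.isCoprime_iff_coprime.mpr cqr))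
      ((Nat.isCoprime_iff_coprime.mpr cpq).mul_dvd d1 d2) d3
    exact ⟨j, by linarith⟩
  have hB' : (r * p * B : ℝ) = 1 + q * tB := by exact_mod_cast hB
  have hC' : (p * q * C : ℝ) = 1 + r * tC := by exact_mod_cast hC
  have hZ' : (A * (q * r) + B * (r * p) + C * (p * q) : ℝ) = 1 + p * q * r * Z := by
    exact_mod_cast hZ
  have E1 : (r : ℝ) * (B * p / q) = 1 / q + tB := by
    field_simp; linarith
  have E2 : (q : ℝ) * (C * p / r) = 1 / r + tC := by
    field_simp; linarith
  have E3 : (A : ℝ) + B * p / q + C * p / r = 1 / (q * r) + p * Z := by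
    field_simp; linarith
  have E4 : (q : ℝ) * (1 / (q * r)) = 1 / r := by field_simp
  have hlam := Int.emod_def (-tB) p
  have hrho := Int.emod_def (-tC) p
  have hc := Int.emod_def A p
  have lam0 := Int.emod_nonneg (-tB) hpz.ne'
  have rho0 := Int.emod_nonneg (-tC) hpz.ne'
  have c0 := Int.emod_nonneg A hpz.ne'
  have lam1 := Int.emod_lt_of_pos (-tB) hpz
  have rho1 := Int.emod_lt_of_pos (-tC) hpz
  have c1 := Int.emod_lt_of_pos A hpz
  have cne : A % p ≠ 0 := by
    intro h
    obtain ⟨w, rfl⟩ := Int.dvd_of_emod_eq_zero h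
    have : (p : ℤ) ∣ 1 := ⟨q * r * w - tA, by linear_combination -hA⟩
    have := Int.le_of_dvd one_pos this
    have := hp.two_le
    omega
  -- Modulo p, -tB and -tC are the inverses of q and r, and A is the inverse of qr. Hence c ≡ lr for
  -- the sides chosen below.
  have hrel : A - tB * tC = p * (A * (r * B + q * C - r * B * p * q * C) + tA * tB * tC) := by
    linear_combination tB * tC * hA + A * r * tC * hB + A * (r * p * B - 1) * hC
  generalize hlamdef : -tB % (p : ℤ) = lam at *
  generalize hrhodef : -tC % (p : ℤ) = rho at *
  generalize hcdef : A % (p : ℤ) = c at *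
  lift lam to ℕ using lam0
  lift rho to ℕ using rho0
  lift c to ℕ using c0
  have hlam' : (lam : ℝ) = -tB - p * (-tB / p : ℤ) := by exact_mod_cast hlam
  have hrho' : (rho : ℝ) = -tC - p * (-tC / p : ℤ) := by exact_mod_cast hrho
  have hc' : (c : ℝ) = A - p * (A / p : ℤ) := by exact_mod_cast hc
  have dig : ∀ (k D : ℤ) (m : ℕ), 0 < m → 0 ≤ ((k * D % m : ℤ) : ℝ) * p / m ∧
      ((k * D % m : ℤ) : ℝ) * p / m ≤ p - p / m := by
    intro k D m hm
    have hmz : (0 : ℤ) < m := by exact_mod_cast hm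
    have hm0 : (0 : ℝ) < m := by exact_mod_cast hm
    have h1 : (0 : ℝ) ≤ ((k * D % m : ℤ) : ℝ) := by exact_mod_cast Int.emod_nonneg _ hmz.ne'
    have h2 : ((k * D % m : ℤ) : ℝ) ≤ m - 1 := by
      have := Int.emod_lt_of_pos (k * D) hmz
      have : k * D % m ≤ m - 1 := by omega
      exact_mod_cast this
    refine ⟨by positivity, ?_⟩
    rw [div_le_iff₀ hm0, sub_mul, div_mul_cancel₀ _ hm0.ne']
    nlinarith
  -- The offsets added to x' and to y, y' are less than the digit spacings p/q and p/r, so no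
  -- coordinate reaches p.
  have small1 : (1 : ℝ) / q < p / q := by
    rw [div_lt_div_iff_of_pos_right hq0]; linarith
  have small2 : ∀ m : ℕ, m < p → ((m : ℝ) + q) * (1 / (q * r)) < p / r := by
    intro m hm
    have hm' : (m : ℝ) + 1 ≤ p := by exact_mod_cast hm
    rw [mul_one_div, div_lt_div_iff₀ (by positivity) hr0]
    have : ((m : ℝ) + q) < p * q := by nlinarith
    nlinarith
  -- Everything is divided by qr. A corner at argument n - e is compared with n itself, and the
  -- offset e/(qr) is split between the coordinates: r/(qr) = 1/q goes to x', while i/(qr) and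
  -- q/(qr) go to y and y'.
  refine ⟨{
    p := p
    l := lam
    r := rho
    c := c
    s := n / (q * r)
    a := -(B * p / q)
    b := -(C * p / r) + 1 / (q * r)
    x := fun i => (((n - i : ℤ) * B % q : ℤ) : ℝ) * p / q
    x' := fun i => (((n - i - r : ℤ) * B % q : ℤ) : ℝ) * p / q + 1 / q
    y := fun i => (((n - i : ℤ) * C % r : ℤ) : ℝ) * p / r + i * (1 / (q * r))
    y' := fun i => (((n - i - q : ℤ) * C % r : ℤ) : ℝ) * p / r + (i + q) * (1 / (q * r))
    u := fun i => (n - i) * A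
    prime := hp
    odd := hp2
    l_le := by omega
    r_le := by omega
    c_pos := by omega
    c_lt := by omega
    rel := ?_
    s_nonneg := by positivity
    s_lt := ?_
    x_mem := ?_
    x'_mem := ?_
    y_mem := ?_
    y'_mem := ?_
    x_side := ?_
    y_side := ?_
    x_step := ?_
    y_step := ?_
    step_sum := ?_
    sum := ?_ }, rfl, ?_⟩
  · left
    rw [hlam, hrho, hc]
    refine ⟨A * (r * B + q * C - r * B * p * q * C) + tA * tB * tC - A / p -
      (-tB / p) * tC - tB * (-tC / p) - p * (-tB / p) * (-tC / p), ?_⟩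
    linear_combination hrel
  · rw [div_lt_iff₀ (by positivity)]
    have : (n : ℝ) < p * q * r := by exact_mod_cast hn
    linarith
  · intro m _
    have := dig (n - m) B q hq.pos
    have : (0 : ℝ) < p / q := by positivity
    constructor <;> linarith
  · intro m _
    have := dig (n - m - r) B q hq.pos
    have : (0 : ℝ) < 1 / q := by positivity
    constructor <;> linarith
  · intro m hm
    have := dig (n - m) C r hr.pos
    have h1 := small2 m hm
    have h2 : (0 : ℝ) ≤ m * (1 / (q * r)) := by positivity
    have h3 : (0 : ℝ) ≤ q * (1 / (q * r)) := by positivity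
    constructor <;> linarith
  · intro m hm
    have := dig (n - m - q) C r hr.pos
    have h1 := small2 m hm
    have h2 : (0 : ℝ) ≤ (m + q) * (1 / (q * r)) := by positivity
    constructor <;> linarith
  · intro m _
    refine ⟨((n - m : ℤ) * B / q) - ((n - m - r : ℤ) * B / q) + (-tB / p), ?_⟩
    rw [real_emod_eq _ _ rfl hq0.ne', real_emod_eq _ _ rfl hq0.ne', hlam']
    push_cast
    linear_combination -E1
  · intro m _
    refine ⟨((n - m : ℤ) * C / r) - ((n - m - q : ℤ) * C / r) + (-tC / p), ?_⟩
    rw [real_emod_eq _ _ rfl hr0.ne', real_emod_eq _ _ rfl hr0.ne', hrho']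
    push_cast
    linear_combination -E2 + E4
  · intro m k _
    refine ⟨((n - m : ℤ) * B / q) - ((n - (m + k : ℕ) : ℤ) * B / q), ?_⟩
    rw [real_emod_eq _ _ rfl hq0.ne', real_emod_eq _ _ rfl hq0.ne']
    push_cast
    ring
  · intro m k _
    refine ⟨((n - m : ℤ) * C / r) - ((n - (m + k : ℕ) : ℤ) * C / r), ?_⟩
    rw [real_emod_eq _ _ rfl hr0.ne', real_emod_eq _ _ rfl hr0.ne']
    push_cast
    ring
  · refine ⟨A / p - Z, ?_⟩
    rw [hc']
    push_cast
    linear_combination -E3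
  · intro m _
    refine ⟨(n - m) * Z - ((n - m : ℤ) * B / q) - ((n - m : ℤ) * C / r), ?_⟩
    rw [real_emod_eq _ _ rfl hq0.ne', real_emod_eq _ _ rfl hr0.ne']
    push_cast
    linear_combination (n - m) * E3
  · rw [coeff_cyclotomic_three_primes hp hq hr hpq.ne (hpq.trans hqr).ne hqr.ne hn]
    refine Finset.sum_congr rfl fun i _ => ?_
    have hnz : (n : ℤ) < p * q * r := by exact_mod_cast hn
    -- Subtracting q does not change the digit modulo q, nor r the digit modulo r. So the shift by r
    -- moves only x, the shift by q only y, and the four arguments form a rectangle.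
    have per1 : ((n - i - q - r : ℤ) * B % q : ℤ) = (n - i - r : ℤ) * B % q := by
      rw [show (n - i - q - r : ℤ) * B = (n - i - r : ℤ) * B + q * (-B) by ring,
        Int.add_mul_emod_self_left]
    have per2 : ((n - i - q - r : ℤ) * C % r : ℤ) = (n - i - q : ℤ) * C % r := by
      rw [show (n - i - q - r : ℤ) * C = (n - i - q : ℤ) * C + r * (-C) by ring,
        Int.add_mul_emod_self_left]
    have per3 : ((n - i - q : ℤ) * B % q : ℤ) = (n - i : ℤ) * B % q := by
      rw [show (n - i - q : ℤ) * B = (n - i : ℤ) * B + q * (-B) by ring,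
        Int.add_mul_emod_self_left]
    have per4 : ((n - i - r : ℤ) * C % r : ℤ) = (n - i : ℤ) * C % r := by
      rw [show (n - i - r : ℤ) * C = (n - i : ℤ) * C + r * (-C) by ring,
        Int.add_mul_emod_self_left]
    have corner : ∀ b c e k : ℤ, k = n - e → ∀ X : ℝ,
        X = (b : ℝ) * p / q + (c : ℝ) * p / r + e * (1 / (q * r)) →
        ((if X ≤ n / (q * r) then 1 else 0 : ℤ) =
          if b * (r * p) + c * (p * q) ≤ k then 1 else 0) := by
      intro b c e k hk X hX
      refine if_congr ?_ rfl rfl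
      rw [hX, hk, le_div_iff₀ (by positivity)]
      have : ((b : ℝ) * p / q + (c : ℝ) * p / r + e * (1 / (q * r))) * (q * r) =
          ((b * (r * p) + c * (p * q) + e : ℤ) : ℝ) := by
        push_cast; field_simp
      rw [this, show (n : ℝ) = ((n : ℤ) : ℝ) by simp, Int.cast_le]
      omega
    rw [reprCount_eq hp.pos hq.pos hr.pos hA hB hC (by omega),
      reprCount_eq hp.pos hq.pos hr.pos hA hB hC (by omega),
      reprCount_eq hp.pos hq.pos hr.pos hA hB hC (by omega),
      reprCount_eq hp.pos hq.pos hr.pos hA hB hC (by omega), per1, per2, per3, per4]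
    unfold cornerDiff
    congr 1
    · congr 1
      · congr 1
        · exact corner _ _ i _ rfl _ (by push_cast; ring)
        · exact corner _ _ (i + r) _ (by ring) _ (by push_cast; field_simp; ring)
      · exact corner _ _ (i + q) _ (by ring) _ (by push_cast; ring)
    · exact corner _ _ (i + q + r) _ (by ring) _ (by push_cast; field_simp; ring)

theorem abs_coeff_le {p q r : ℕ} (hp : p.Prime) (hp2 : p % 2 = 1) (hq : q.Prime)
    (hr : r.Prime) (hpq : p < q) (hqr : q < r) (n : ℕ) :
    3 * ((Polynomial.cyclotomic (p * q * r) ℤ).coeff n).natAbs ≤ 2 * p := by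
  rcases lt_or_ge n (p * q * r) with hn | hn
  · obtain ⟨R, hRp, hR⟩ := exists_rectangleWalk hp hp2 hq hr hpq hqr hn
    have := R.abs_total_le
    rw [hR, hRp, Int.abs_eq_natAbs] at this
    omega
  · have h1 : 1 < p * q * r := by
      have h1 := hp.one_lt
      have h2 := Nat.mul_pos hq.pos hr.pos
      nlinarith
    rw [Polynomial.coeff_eq_zero_of_natDegree_lt]
    · simp
    · rw [Polynomial.natDegree_cyclotomic]
      exact (Nat.totient_lt _ h1).trans_le hn

theorem cyclotomicHeight_le {p q r : ℕ} (hp : p.Prime) (hp2 : p % 2 = 1) (hq : q.Prime)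
    (hr : r.Prime) (hpq : p < q) (hqr : q < r) : 3 * cyclotomicHeight (p * q * r) ≤ 2 * p := by
  have : cyclotomicHeight (p * q * r) ≤ 2 * p / 3 := Finset.sup_le fun n _ => by
    have := abs_coeff_le hp hp2 hq hr hpq hqr n
    omega
  omega

theorem theorem2p6 (p : ℕ) (hp : p.Prime) (hp_odd : Odd p) :
    (∀ q r : ℕ, q.Prime → r.Prime → p < q → q < r →
      (cyclotomicHeight (p * q * r) : ℝ) ≤ 2 / 3 * (p : ℝ)) ∧
    IsGreatest (ternaryHeights p) (ternaryMaxHeight p) ∧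
    (ternaryMaxHeight p : ℝ) ≤ 2 / 3 * (p : ℝ) := by
  have hp2 := Nat.odd_iff.mp hp_odd
  have cast : ∀ h : ℕ, 3 * h ≤ 2 * p → (h : ℝ) ≤ 2 / 3 * (p : ℝ) := fun h hh => by
    have : (3 * h : ℝ) ≤ 2 * p := by exact_mod_cast hh
    linarith
  have bound : ∀ a ∈ ternaryHeights p, 3 * a ≤ 2 * p := by
    rintro a ⟨q, r, hq, hr, hpq, hqr, rfl⟩
    exact cyclotomicHeight_le hp hp2 hq hr hpq hqr
  have hbdd : BddAbove (ternaryHeights p) := ⟨2 * p, fun a ha => by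
    have := bound a ha
    omega⟩
  have hne : (ternaryHeights p).Nonempty := by
    obtain ⟨q, hpq, hq⟩ := Nat.exists_infinite_primes (p + 1)
    obtain ⟨r, hqr, hr⟩ := Nat.exists_infinite_primes (q + 1)
    exact ⟨_, q, r, hq, hr, hpq, hqr, rfl⟩
  have hmem : ternaryMaxHeight p ∈ ternaryHeights p := Nat.sSup_mem hne hbdd
  exact ⟨fun q r hq hr hpq hqr => cast _ (cyclotomicHeight_le hp hp2 hq hr hpq hqr),
    ⟨hmem, fun a ha => le_csSup hbdd ha⟩, cast _ (bound _ hmem)⟩
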